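/- A C*-category $\mathcal C$ is a $\mathbb C$-linear category whose morphism spaces $(X,Y)$ are complex Banach spaces, with a conjugate-linear involution $(X,Y)\ni a\mapsto a^*\in(Y,X)$ satisfying $a^{**}=a$ and $(ba)^*=a^*b^*$, with $\|ba\|\le\|b\|\|a\|$ and $\|h\|^2=\|h^*h\|$, and such that for each $h\in(X,Y)$ there is $g\in(X,X)$ with $h^*h=g^*g$. A C*-functor is a linear functor commuting with the involutions; it is faithful if it is injective on each morphism space. Let $(X,Y)'$ and $(X,Y)''$ be the Banach dual and bidual of $(X,Y)$, and $a\mapsto\hat a$ the canonical inclusion. **Arens composition.** For $F\in(X,Y)''$ and $G\in(Y,Z)''$ define $G\circ F\in(X,Z)''$ by $\langle G\circ F,f\rangle=\langle G,fF\rangle$ for $f\in(X,Z)'$, where $\langle fF,b\rangle=\langle F,bf\rangle$ for $b\in(Y,Z)$ and $\langle bf,a\rangle=\langle f,ba\rangle$ for $a\in(X,Y)$. **Sherman–Takeda composition.** Let $\rho$ be a faithful C*-functor from $\mathcal C$ to the C*-category of complex Hilbert spaces and bounded operators. Let $A$ be the C*-algebra of operators on the Hilbert sum $\bigoplus_X\rho(X)$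 over all objects generated by all $\rho(a)$ (regarded as matrix entries), let $\pi$ be the universal representation of $A$ (the direct sum of the GNS representations of all states) on $H_\pi$, and set $\sigma=\pi\circ\rho$. Let $\mathcal S(X,Y)$ be the weak operator closure of $\sigma((X,Y))$ in $B(H_\pi)$, and let $\tau=\sigma''$ be given on $(X,Y)''$ by $\langle\eta,\tau(F)\xi\rangle=\langle F,\ a\mapsto\langle\eta,\sigma(a)\xi\rangle\rangle$ for $\xi,\eta\in H_\pi$ (inner products linear in the second variable). Set $G\bullet F=\tau^{-1}(\tau(G)\tau(F))$. Equip the spaces $(X,Y)''$ with the dual norms, the identities $\widehat{1_X}$, and the involution $\langle F^*,f\rangle=\overline{\langle F,f^*\rangle}$, where $\langle f^*,a\rangle=\overline{\langle f,a^*\rangle}$. With $\circ$ this is the Arens bidual, with $\bullet$ the Sherman–Takeda bidual; both have the objects of $\mathcal C$. **Proposition.** Let $\mathcal C$ be a C*-category. There is a faithful C*-functor from $\mathcal C$ to the C*-category of Hilbert spaces, and for every such functor $\rho$: 1. $\tau(\hat a)=\sigma(a)$ for all morphisms $a$; each $\tau:(X,Y)''\to\mathcal S(X,Y)$ is a bijection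 and a homeomorphism from the weak* topology to the weak operator topology; and $\tau(G)\tau(F)\in\mathcal S(X,Z)$ for $F\in(X,Y)''$, $G\in(Y,Z)''$. Hence $G\bullet F$ is well defined and $\tau(G\bullet F)=\tau(G)\tau(F)$. 2. The Sherman–Takeda bidual and the Arens bidual are C*-categories. 3. $G\circ F=G\bullet F$ for all $F\in(X,Y)''$, $G\in(Y,Z)''$; that is, the Arens bidual coincides with the Sherman–Takeda bidual. -/

import Mathlib

open CategoryTheory
open scoped InnerProductSpace ComplexOrder

universe u v w

noncomputable section

/-! ### C*-categories -/

/-- The data of a C*-category: objects, normed complex morphism spaces, identities,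
composition (`a ≫ b` is the composite `b ∘ a`) and an involution. -/
class CStarCategoryStruct (C : Type u) extends CategoryStruct.{v} C where
  normedHom : ∀ X Y : C, NormedAddCommGroup (X ⟶ Y)
  spaceHom : ∀ X Y : C, NormedSpace ℂ (X ⟶ Y)
  /-- the involution `(X, Y) → (Y, X)`, `a ↦ a*` -/
  adj : ∀ {X Y : C}, (X ⟶ Y) → (Y ⟶ X)

attribute [reducible, instance] CStarCategoryStruct.normedHom CStarCategoryStruct.spaceHom

open CStarCategoryStruct (adj)

/-- The axioms of a C*-category. -/
class IsCStarCategory (C : Type u) [CStarCategoryStruct.{u, v} C] : Prop where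
  id_comp : ∀ {X Y : C} (a : X ⟶ Y), 𝟙 X ≫ a = a
  comp_id : ∀ {X Y : C} (a : X ⟶ Y), a ≫ 𝟙 Y = a
  assoc : ∀ {X Y Z W : C} (a : X ⟶ Y) (b : Y ⟶ Z) (c : Z ⟶ W), (a ≫ b) ≫ c = a ≫ b ≫ c
  complete : ∀ X Y : C, CompleteSpace (X ⟶ Y)
  add_comp : ∀ {X Y Z : C} (a a' : X ⟶ Y) (b : Y ⟶ Z), (a + a') ≫ b = a ≫ b + a' ≫ b
  comp_add : ∀ {X Y Z : C} (a : X ⟶ Y) (b b' : Y ⟶ Z), a ≫ (b + b') = a ≫ b + a ≫ b'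
  smul_comp : ∀ {X Y Z : C} (c : ℂ) (a : X ⟶ Y) (b : Y ⟶ Z), (c • a) ≫ b = c • (a ≫ b)
  comp_smul : ∀ {X Y Z : C} (c : ℂ) (a : X ⟶ Y) (b : Y ⟶ Z), a ≫ (c • b) = c • (a ≫ b)
  adj_add : ∀ {X Y : C} (a a' : X ⟶ Y), adj (a + a') = adj a + adj a'
  adj_smul : ∀ {X Y : C} (c : ℂ) (a : X ⟶ Y), adj (c • a) = star c • adj a
  adj_adj : ∀ {X Y : C} (a : X ⟶ Y), adj (adj a) = a
  adj_comp : ∀ {X Y Z : C} (a : X ⟶ Y) (b : Y ⟶ Z), adj (a ≫ b) = adj b ≫ adj a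
  norm_comp_le : ∀ {X Y Z : C} (a : X ⟶ Y) (b : Y ⟶ Z), ‖a ≫ b‖ ≤ ‖a‖ * ‖b‖
  norm_sq : ∀ {X Y : C} (h : X ⟶ Y), ‖h‖ ^ 2 = ‖h ≫ adj h‖
  pos : ∀ {X Y : C} (h : X ⟶ Y), ∃ g : X ⟶ X, h ≫ adj h = g ≫ adj g

attribute [instance] IsCStarCategory.complete

/-- A C*-functor: a linear functor compatible with the involutions. -/
structure CStarFunctor (C : Type u) [CStarCategoryStruct.{u, v} C]
    (D : Type*) [CStarCategoryStruct D] where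
  obj : C → D
  map : ∀ {X Y : C}, (X ⟶ Y) →ₗ[ℂ] (obj X ⟶ obj Y)
  map_id : ∀ X : C, map (𝟙 X) = 𝟙 (obj X)
  map_comp : ∀ {X Y Z : C} (a : X ⟶ Y) (b : Y ⟶ Z), map (a ≫ b) = map a ≫ map b
  map_adj : ∀ {X Y : C} (a : X ⟶ Y),
    map (adj a) = adj (map a)

/-- A functor is faithful when it is injective on every morphism space. -/
def CStarFunctor.Faithful {C : Type u} [CStarCategoryStruct.{u, v} C]
    {D : Type*} [CStarCategoryStruct D] (ρ : CStarFunctor C D) : Prop :=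
  ∀ X Y : C, Function.Injective (ρ.map : (X ⟶ Y) → (ρ.obj X ⟶ ρ.obj Y))

/-! ### The C*-category of Hilbert spaces -/

/-- Complex Hilbert spaces. -/
structure HilbSp where
  carrier : Type w
  [normed : NormedAddCommGroup carrier]
  [innerSpace : InnerProductSpace ℂ carrier]
  [complete : CompleteSpace carrier]

instance : CoeSort HilbSp.{w} (Type w) := ⟨HilbSp.carrier⟩

attribute [instance] HilbSp.normed HilbSp.innerSpace HilbSp.complete

instance HilbSp.cstarCategoryStruct : CStarCategoryStruct.{w + 1, w} HilbSp.{w} where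
  Hom H K := H →L[ℂ] K
  id H := ContinuousLinearMap.id ℂ H
  comp S T := T ∘L S
  normedHom H K := inferInstanceAs (NormedAddCommGroup (H →L[ℂ] K))
  spaceHom H K := inferInstanceAs (NormedSpace ℂ (H →L[ℂ] K))
  adj T := ContinuousLinearMap.adjoint T

instance HilbSp.isCStarCategory : IsCStarCategory HilbSp.{w} where
  id_comp _ := rfl
  comp_id _ := rfl
  assoc _ _ _ := rfl
  complete H K := inferInstanceAs (CompleteSpace (H →L[ℂ] K))
  add_comp S S' T := ContinuousLinearMap.comp_add T S S'
  comp_add S T T' := ContinuousLinearMap.add_comp T T' S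
  smul_comp c S T := ContinuousLinearMap.comp_smul T c S
  comp_smul c S T := ContinuousLinearMap.smul_comp c T S
  adj_add S T := map_add ContinuousLinearMap.adjoint S T
  adj_smul c T := map_smulₛₗ ContinuousLinearMap.adjoint c T
  adj_adj T := ContinuousLinearMap.adjoint_adjoint T
  adj_comp S T := ContinuousLinearMap.adjoint_comp T S
  norm_comp_le S T := (ContinuousLinearMap.opNorm_comp_le T S).trans_eq (mul_comm _ _)
  norm_sq {H K} T := by
    rw [sq]
    exact (ContinuousLinearMap.norm_adjoint_comp_self (E := H) (F := K) T).symm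
  pos {H K} T := by
    let P : H →L[ℂ] H := ContinuousLinearMap.adjoint (show H →L[ℂ] K from T) ∘L
      (show H →L[ℂ] K from T)
    have hP : 0 ≤ P := by
      rw [ContinuousLinearMap.nonneg_iff_isPositive]
      exact ContinuousLinearMap.isPositive_adjoint_comp_self (show H →L[ℂ] K from T)
    obtain ⟨g, hg⟩ := CStarAlgebra.nonneg_iff_eq_star_mul_self.mp hP
    exact ⟨g, hg⟩

/-! ### The Arens bidual -/

section Arens

variable {C : Type u} [CStarCategoryStruct.{u, v} C] [IsCStarCategory C]

open IsCStarCategory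

theorem IsCStarCategory.norm_adj {X Y : C} (a : X ⟶ Y) : ‖adj a‖ = ‖a‖ := by
  have key : ∀ {X Y : C} (a : X ⟶ Y), ‖a‖ ≤ ‖adj a‖ := by
    intro X Y a
    by_cases h : ‖a‖ = 0
    · rw [h]; exact norm_nonneg _
    · have h1 : ‖a‖ * ‖a‖ ≤ ‖a‖ * ‖adj a‖ := by
        rw [← sq, norm_sq a]; exact norm_comp_le _ _
      exact le_of_mul_le_mul_left h1 (lt_of_le_of_ne (norm_nonneg _) (Ne.symm h))
  refine le_antisymm ?_ (key a)
  have := key (adj a)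
  rwa [adj_adj] at this

/-- The bidual `(X, Y)''` of a morphism space. -/
abbrev Bidual (X Y : C) : Type v := StrongDual ℂ (StrongDual ℂ (X ⟶ Y))

/-- The canonical inclusion `a ↦ â` of `(X, Y)` into its bidual. -/
abbrev hat {X Y : C} : (X ⟶ Y) →L[ℂ] Bidual X Y :=
  NormedSpace.inclusionInDoubleDual ℂ (X ⟶ Y)

/-- Composition `b ↦ a ↦ ba` as a bounded bilinear map. -/
def compCLM (X Y Z : C) : (Y ⟶ Z) →L[ℂ] (X ⟶ Y) →L[ℂ] (X ⟶ Z) :=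
  LinearMap.mkContinuous₂
    (LinearMap.mk₂ ℂ (fun (b : Y ⟶ Z) (a : X ⟶ Y) => a ≫ b)
      (fun b b' a => comp_add a b b') (fun c b a => comp_smul c a b)
      (fun b a a' => add_comp a a' b) (fun c b a => smul_comp c a b)) 1
    (fun b a => by
      rw [one_mul, mul_comm]
      exact norm_comp_le a b)

@[simp]
theorem compCLM_apply {X Y Z : C} (b : Y ⟶ Z) (a : X ⟶ Y) : compCLM X Y Z b a = a ≫ b := rfl

/-- `bf ∈ (X, Y)'` for `f ∈ (X, Z)'` and `b ∈ (Y, Z)`: `⟨bf, a⟩ = ⟨f, ba⟩`. -/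
def arensLeft {X Y Z : C} (f : StrongDual ℂ (X ⟶ Z)) :
    (Y ⟶ Z) →L[ℂ] StrongDual ℂ (X ⟶ Y) :=
  (ContinuousLinearMap.compL ℂ (X ⟶ Y) (X ⟶ Z) ℂ f) ∘L compCLM X Y Z

@[simp]
theorem arensLeft_apply {X Y Z : C} (f : StrongDual ℂ (X ⟶ Z)) (b : Y ⟶ Z) (a : X ⟶ Y) :
    arensLeft f b a = f (a ≫ b) := rfl

/-- `fF ∈ (Y, Z)'` for `F ∈ (X, Y)''` and `f ∈ (X, Z)'`: `⟨fF, b⟩ = ⟨F, bf⟩`. -/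
def arensMiddle {X Y Z : C} (F : Bidual X Y) :
    StrongDual ℂ (X ⟶ Z) →L[ℂ] StrongDual ℂ (Y ⟶ Z) :=
  (ContinuousLinearMap.compL ℂ (Y ⟶ Z) (StrongDual ℂ (X ⟶ Y)) ℂ F) ∘L
    ((ContinuousLinearMap.compL ℂ (Y ⟶ Z) ((X ⟶ Y) →L[ℂ] (X ⟶ Z)) (StrongDual ℂ (X ⟶ Y))).flip
      (compCLM X Y Z)) ∘L
    (ContinuousLinearMap.compL ℂ (X ⟶ Y) (X ⟶ Z) ℂ)

@[simp]
theorem arensMiddle_apply {X Y Z : C} (F : Bidual X Y) (f : StrongDual ℂ (X ⟶ Z)) (b : Y ⟶ Z) :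
    arensMiddle F f b = F (arensLeft f b) := rfl

/-- The Arens composition `G ∘ F ∈ (X, Z)''`: `⟨G ∘ F, f⟩ = ⟨G, fF⟩`. -/
def arensComp {X Y Z : C} (G : Bidual Y Z) (F : Bidual X Y) : Bidual X Z :=
  G ∘L arensMiddle F

@[simp]
theorem arensComp_apply {X Y Z : C} (G : Bidual Y Z) (F : Bidual X Y)
    (f : StrongDual ℂ (X ⟶ Z)) : arensComp G F f = G (arensMiddle F f) := rfl

/-- `f* ∈ (X, Y)'` for `f ∈ (Y, X)'`: `⟨f*, a⟩` is the conjugate of `⟨f, a*⟩`. -/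
def dualAdj {X Y : C} (f : StrongDual ℂ (Y ⟶ X)) : StrongDual ℂ (X ⟶ Y) :=
  LinearMap.mkContinuous
    { toFun := fun a => star (f (adj a))
      map_add' := fun a b => by rw [adj_add, map_add, star_add]
      map_smul' := fun c a => by
        rw [adj_smul, map_smul, smul_eq_mul, star_mul', star_star]; rfl } ‖f‖
    (fun a => by
      change ‖star (f (adj a))‖ ≤ _
      rw [norm_star, ← norm_adj a]
      exact f.le_opNorm _)

@[simp]
theorem dualAdj_apply {X Y : C} (f : StrongDual ℂ (Y ⟶ X)) (a : X ⟶ Y) :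
    dualAdj f a = star (f (adj a)) := rfl

theorem norm_dualAdj_le {X Y : C} (f : StrongDual ℂ (Y ⟶ X)) : ‖dualAdj f‖ ≤ ‖f‖ :=
  LinearMap.mkContinuous_norm_le _ (norm_nonneg _) _

/-- `F* ∈ (Y, X)''` for `F ∈ (X, Y)''`: `⟨F*, f⟩` is the conjugate of `⟨F, f*⟩`. -/
def bidualAdj {X Y : C} (F : Bidual X Y) : Bidual Y X :=
  LinearMap.mkContinuous
    { toFun := fun f => star (F (dualAdj f))
      map_add' := fun f g => by
        have : dualAdj (f + g) = dualAdj f + dualAdj g := by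
          ext a; simp
        rw [this, map_add, star_add]
      map_smul' := fun c f => by
        have : dualAdj (c • f) = star c • dualAdj f := by
          ext a; simp
        rw [this, map_smul, smul_eq_mul, star_mul', star_star]; rfl } ‖F‖
    (fun f => by
      change ‖star (F (dualAdj f))‖ ≤ _
      rw [norm_star]
      exact (F.le_opNorm _).trans
        (mul_le_mul_of_nonneg_left (norm_dualAdj_le f) (norm_nonneg F)))

@[simp]
theorem bidualAdj_apply {X Y : C} (F : Bidual X Y) (f : StrongDual ℂ (Y ⟶ X)) :
    bidualAdj F f = star (F (dualAdj f)) := rfl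

variable (C) in
/-- The Arens bidual of a C*-category: the same objects, morphism spaces `(X, Y)''`, the Arens
composition, the identities `1̂`, and the bitransposed involution. -/
@[reducible]
def arensBidual : CStarCategoryStruct.{u, v} C where
  Hom X Y := Bidual X Y
  id X := hat (𝟙 X)
  comp F G := arensComp G F
  normedHom X Y := inferInstanceAs (NormedAddCommGroup (Bidual X Y))
  spaceHom X Y := inferInstanceAs (NormedSpace ℂ (Bidual X Y))
  adj F := bidualAdj F

end Arens

/-! ### The universal representation of a C*-algebra -/

section Universal

section DirectSum

variable {ι : Type*} {E : ι → Type*} [∀ i, NormedAddCommGroup (E i)]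
  [∀ i, InnerProductSpace ℂ (E i)]

/-- The diagonal operator `⨁ T i` on the Hilbert sum, for a uniformly bounded family `T`. -/
def diagOp (T : ∀ i, E i →L[ℂ] E i) (M : ℝ) (hM : 0 ≤ M) (hT : ∀ i, ‖T i‖ ≤ M) :
    lp E 2 →L[ℂ] lp E 2 :=
  have hle : ∀ (x : lp E 2) (i : ι), ‖T i (x i)‖ ≤ ‖(M : ℂ) • x i‖ := fun x i => by
    rw [norm_smul, Complex.norm_real, Real.norm_of_nonneg hM]
    exact (T i).le_of_opNorm_le (hT i) _
  have hmem : ∀ x : lp E 2, Memℓp (fun i => T i (x i)) 2 := fun x =>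
    (((M : ℂ) • x : lp E 2).2).mono' (hle x)
  LinearMap.mkContinuous
    { toFun := fun x => (⟨fun i => T i (x i), hmem x⟩ : lp E 2)
      map_add' := fun x y => by ext i; exact map_add (T i) _ _
      map_smul' := fun c x => by ext i; exact map_smul (T i) _ _ } M
    (fun x => by
      have : ‖(⟨fun i => T i (x i), hmem x⟩ : lp E 2)‖ ≤ ‖(M : ℂ) • x‖ :=
        lp.norm_mono two_ne_zero (hle x)
      rwa [norm_smul, Complex.norm_real, Real.norm_of_nonneg hM] at this)

@[simp]
theorem diagOp_apply (T : ∀ i, E i →L[ℂ] E i) (M : ℝ) (hM : 0 ≤ M) (hT : ∀ i, ‖T i‖ ≤ M)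
    (x : lp E 2) (i : ι) : diagOp T M hM hT x i = T i (x i) := rfl

/-- The Hilbert direct sum of a family of representations of a C*-algebra. -/
def directSumRep {A : Type*} [NonUnitalCStarAlgebra A] [∀ i, CompleteSpace (E i)]
    (π : ∀ i, A →⋆ₙₐ[ℂ] (E i →L[ℂ] E i)) : A →⋆ₙₐ[ℂ] (lp E 2 →L[ℂ] lp E 2) where
  toFun a := diagOp (fun i => π i a) ‖a‖ (norm_nonneg a)
    (fun i => NonUnitalStarAlgHom.norm_apply_le (π i) a)
  map_smul' c a := by ext x i; simp
  map_zero' := by ext x i; simp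
  map_add' a b := by ext x i; simp
  map_mul' a b := by ext x i; simp
  map_star' a := by
    rw [ContinuousLinearMap.star_eq_adjoint, ContinuousLinearMap.eq_adjoint_iff]
    intro x y
    rw [lp.inner_eq_tsum, lp.inner_eq_tsum]
    refine tsum_congr fun i => ?_
    rw [diagOp_apply, diagOp_apply, map_star, ContinuousLinearMap.star_eq_adjoint,
      ContinuousLinearMap.adjoint_inner_left]

end DirectSum

variable (A : Type u) [NonUnitalCStarAlgebra A] [PartialOrder A] [StarOrderedRing A]

/-- States of a (possibly non-unital) C*-algebra: positive functionals of norm one. -/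
def CStarState : Type u :=
  {φ : StrongDual ℂ A // (∀ a : A, 0 ≤ a → 0 ≤ φ a) ∧ ‖φ‖ = 1}

variable {A} in
/-- A state as a positive linear map. -/
def CStarState.toPositive (φ : CStarState A) : A →ₚ[ℂ] ℂ :=
  PositiveLinearMap.mk₀ (φ.1 : A →ₗ[ℂ] ℂ) φ.2.1

/-- The Hilbert space of the universal representation: the Hilbert sum, over all states, of the
GNS spaces. -/
abbrev UnivSpace : Type u := lp (fun φ : CStarState A => φ.toPositive.GNS) 2

/-- The universal representation: the direct sum, over all states, of the GNS representations. -/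
def univRep : A →⋆ₙₐ[ℂ] (UnivSpace A →L[ℂ] UnivSpace A) :=
  directSumRep fun φ : CStarState A => φ.toPositive.gnsNonUnitalStarAlgHom

end Universal

/-! ### The Sherman-Takeda bidual -/

section ShermanTakeda

open IsCStarCategory

section EndAlgebra

variable {C : Type u} [CStarCategoryStruct.{u, v} C] [IsCStarCategory C]

/-- The endomorphism space `(X, X)` as a normed ring. -/
@[reducible]
def endNormedRing (X : C) : NonUnitalNormedRing (X ⟶ X) :=
  { (inferInstance : NormedAddCommGroup (X ⟶ X)) with
    mul := fun b a => a ≫ b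
    mul_assoc := fun a b c => (IsCStarCategory.assoc c b a).symm
    left_distrib := fun a b c => add_comp b c a
    right_distrib := fun a b c => comp_add c a b
    zero_mul := fun a => by
      have := comp_smul (0 : ℂ) a (0 : X ⟶ X)
      rwa [zero_smul, zero_smul] at this
    mul_zero := fun a => by
      have := smul_comp (0 : ℂ) (0 : X ⟶ X) a
      rwa [zero_smul, zero_smul] at this
    norm_mul_le := fun a b => (norm_comp_le b a).trans_eq (mul_comm _ _) }

/-- The endomorphism space `(X, X)` as a C*-algebra. -/
@[reducible]
def endCStarAlgebra (X : C) : NonUnitalCStarAlgebra (X ⟶ X) :=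
  letI := endNormedRing X
  { endNormedRing X, (inferInstance : NormedSpace ℂ (X ⟶ X)), complete X X with
    star := fun a => adj a
    star_involutive := fun a => adj_adj a
    star_mul := fun a b => adj_comp b a
    star_add := fun a b => adj_add a b
    norm_mul_self_le := fun a => by
      rw [← sq, norm_sq]
      exact le_rfl
    smul_assoc := fun c a b => comp_smul c b a
    smul_comm := fun c a b => (smul_comp c b a).symm
    star_smul := fun c a => adj_smul c a }

end EndAlgebra

variable {C : Type u} [CStarCategoryStruct.{u, v} C]

namespace CStarFunctor

variable (ρ : CStarFunctor C HilbSp.{w})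

/-- The operator `ρ(a) : ρ(X) → ρ(Y)`. -/
abbrev op {X Y : C} (a : X ⟶ Y) : ρ.obj X →L[ℂ] ρ.obj Y := ρ.map a

/-- The Hilbert sum of the spaces `ρ(X)` over all objects `X`. -/
abbrev TotalSpace : Type (max u w) := lp (fun X : C => ρ.obj X) 2

open Classical in
/-- An operator `ρ(X) → ρ(Y)` regarded as a matrix entry, that is as an operator on the Hilbert
sum. -/
def block (X Y : C) (T : ρ.obj X →L[ℂ] ρ.obj Y) : ρ.TotalSpace →L[ℂ] ρ.TotalSpace :=
  lp.singleContinuousLinearMap ℂ (fun X : C => (ρ.obj X : Type w)) 2 Y ∘L T ∘L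
    lp.evalCLM ℂ (fun X : C => (ρ.obj X : Type w)) 2 X

open Classical in
theorem norm_block_le (X Y : C) (T : ρ.obj X →L[ℂ] ρ.obj Y) : ‖ρ.block X Y T‖ ≤ ‖T‖ := by
  refine ContinuousLinearMap.opNorm_le_bound _ (norm_nonneg T) fun x => ?_
  have h : ‖ρ.block X Y T x‖ = ‖T (x X)‖ :=
    lp.norm_single (E := fun X : C => (ρ.obj X : Type w)) (p := 2) (by norm_num) Y (T (x X))
  rw [h]
  exact (T.le_opNorm _).trans (mul_le_mul_of_nonneg_left
    (lp.norm_apply_le_norm two_ne_zero x X) (norm_nonneg T))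

/-- The C*-algebra of operators on the Hilbert sum generated by all `ρ(a)`. -/
def genSubalgebra : NonUnitalStarSubalgebra ℂ (ρ.TotalSpace →L[ℂ] ρ.TotalSpace) :=
  (NonUnitalStarAlgebra.adjoin ℂ
    {T | ∃ (X Y : C) (a : X ⟶ Y), T = ρ.block X Y (ρ.op a)}).topologicalClosure

/-- The C*-algebra generated by all `ρ(a)`, as a type. -/
def GenAlgebra : Type (max u w) := ρ.genSubalgebra

instance : NonUnitalCStarAlgebra ρ.GenAlgebra :=
  haveI : IsClosed (ρ.genSubalgebra : Set (ρ.TotalSpace →L[ℂ] ρ.TotalSpace)) :=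
    NonUnitalStarSubalgebra.isClosed_topologicalClosure _
  inferInstanceAs (NonUnitalCStarAlgebra ρ.genSubalgebra)

instance : PartialOrder ρ.GenAlgebra := CStarAlgebra.spectralOrder ρ.GenAlgebra

instance : StarOrderedRing ρ.GenAlgebra := CStarAlgebra.spectralOrderedRing ρ.GenAlgebra

/-- `a ↦ ρ(a)`, with values in the generated C*-algebra. -/
def toGen {X Y : C} (a : X ⟶ Y) : ρ.GenAlgebra :=
  ⟨ρ.block X Y (ρ.op a), NonUnitalStarSubalgebra.le_topologicalClosure _
    (NonUnitalStarAlgebra.subset_adjoin ℂ _ ⟨X, Y, a, rfl⟩)⟩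

/-- The Hilbert space of the universal representation of the generated C*-algebra. -/
abbrev HUniv : Type (max u w) := UnivSpace ρ.GenAlgebra

theorem toGen_add {X Y : C} (a b : X ⟶ Y) : ρ.toGen (a + b) = ρ.toGen a + ρ.toGen b := by
  have h : ρ.block X Y (ρ.op (a + b)) = ρ.block X Y (ρ.op a) + ρ.block X Y (ρ.op b) := by
    have h1 : ρ.op (a + b) = ρ.op a + ρ.op b := map_add ρ.map a b
    rw [h1, block, block, block, ContinuousLinearMap.add_comp, ContinuousLinearMap.comp_add]
  exact Subtype.ext h

theorem toGen_smul {X Y : C} (c : ℂ) (a : X ⟶ Y) : ρ.toGen (c • a) = c • ρ.toGen a := by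
  have h : ρ.block X Y (ρ.op (c • a)) = c • ρ.block X Y (ρ.op a) := by
    have h1 : ρ.op (c • a) = c • ρ.op a := map_smul ρ.map c a
    rw [h1, block, block, ContinuousLinearMap.smul_comp, ContinuousLinearMap.comp_smul]
  exact Subtype.ext h

variable [IsCStarCategory C]

theorem norm_op_le {X Y : C} (a : X ⟶ Y) : ‖ρ.op a‖ ≤ ‖a‖ := by
  let _ := endCStarAlgebra X
  let φ : (X ⟶ X) →⋆ₙₐ[ℂ] (ρ.obj X →L[ℂ] ρ.obj X) :=
    { toFun := fun b => ρ.op b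
      map_smul' := fun c b => map_smul ρ.map c b
      map_zero' := map_zero ρ.map
      map_add' := fun b c => map_add ρ.map b c
      map_mul' := fun b c => ρ.map_comp c b
      map_star' := fun b => ρ.map_adj b }
  have h1 : ‖ρ.op (a ≫ adj a)‖ ≤ ‖a ≫ adj a‖ := NonUnitalStarAlgHom.norm_apply_le φ (a ≫ adj a)
  have h2 : ρ.op (a ≫ adj a) = ContinuousLinearMap.adjoint (ρ.op a) ∘L ρ.op a := by
    change ρ.map (a ≫ adj a) = _
    rw [ρ.map_comp, ρ.map_adj]
    rfl
  rw [h2, ContinuousLinearMap.norm_adjoint_comp_self, ← norm_sq, ← sq] at h1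
  exact le_of_sq_le_sq h1 (norm_nonneg a)

theorem norm_toGen_le {X Y : C} (a : X ⟶ Y) : ‖ρ.toGen a‖ ≤ ‖a‖ :=
  (ρ.norm_block_le X Y (ρ.op a)).trans (ρ.norm_op_le a)

theorem norm_univRep_toGen_le {X Y : C} (a : X ⟶ Y) :
    ‖univRep ρ.GenAlgebra (ρ.toGen a)‖ ≤ ‖a‖ :=
  (NonUnitalStarAlgHom.norm_apply_le (univRep ρ.GenAlgebra) (ρ.toGen a)).trans
    (ρ.norm_toGen_le a)

/-- `σ = π ∘ ρ`, where `π` is the universal representation of the generated C*-algebra. -/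
def sigma {X Y : C} : (X ⟶ Y) →L[ℂ] (ρ.HUniv →L[ℂ] ρ.HUniv) :=
  LinearMap.mkContinuous
    { toFun := fun a => univRep ρ.GenAlgebra (ρ.toGen a)
      map_add' := fun a b => by rw [toGen_add, map_add]
      map_smul' := fun c a => by rw [toGen_smul, map_smul, RingHom.id_apply] } 1
    (fun a => (ρ.norm_univRep_toGen_le a).trans_eq (one_mul _).symm)

theorem sigma_apply {X Y : C} (a : X ⟶ Y) :
    ρ.sigma a = univRep ρ.GenAlgebra (ρ.toGen a) := rfl

/-- `𝒮(X, Y)`: the closure of `σ((X, Y))` in the weak operator topology. -/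
def wotClosure (X Y : C) : Set (ρ.HUniv →WOT[ℂ] ρ.HUniv) :=
  closure (Set.range fun a : X ⟶ Y => ContinuousLinearMapWOT.ofCLM (ρ.sigma a))

/-- The functional `a ↦ ⟪η, σ(a) ξ⟫` on `(X, Y)`, sesquilinear in `(η, ξ)`. -/
def coeffFunctional (X Y : C) : ρ.HUniv →L⋆[ℂ] ρ.HUniv →L[ℂ] StrongDual ℂ (X ⟶ Y) :=
  LinearMap.mkContinuous₂
    (LinearMap.mk₂'ₛₗ (starRingEnd ℂ) (RingHom.id ℂ)
      (fun η ξ : ρ.HUniv =>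
        (innerSL ℂ η ∘L (ContinuousLinearMap.apply ℂ ρ.HUniv ξ) ∘L ρ.sigma :
          StrongDual ℂ (X ⟶ Y)))
      (fun η η' ξ => by
        ext a
        change ⟪η + η', ρ.sigma a ξ⟫_ℂ = ⟪η, ρ.sigma a ξ⟫_ℂ + ⟪η', ρ.sigma a ξ⟫_ℂ
        rw [inner_add_left])
      (fun c η ξ => by
        ext a
        change ⟪c • η, ρ.sigma a ξ⟫_ℂ = starRingEnd ℂ c • ⟪η, ρ.sigma a ξ⟫_ℂ
        rw [inner_smul_left, smul_eq_mul])
      (fun η ξ ξ' => by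
        ext a
        change ⟪η, ρ.sigma a (ξ + ξ')⟫_ℂ = ⟪η, ρ.sigma a ξ⟫_ℂ + ⟪η, ρ.sigma a ξ'⟫_ℂ
        rw [map_add, inner_add_right])
      (fun c η ξ => by
        ext a
        change ⟪η, ρ.sigma a (c • ξ)⟫_ℂ = c • ⟪η, ρ.sigma a ξ⟫_ℂ
        rw [map_smul, inner_smul_right, smul_eq_mul])) 1
    (fun η ξ => by
      refine ContinuousLinearMap.opNorm_le_bound _ (by positivity) fun a => ?_
      change ‖⟪η, ρ.sigma a ξ⟫_ℂ‖ ≤ _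
      have h1 : ‖ρ.sigma a‖ ≤ ‖a‖ := ρ.norm_univRep_toGen_le a
      calc ‖⟪η, ρ.sigma a ξ⟫_ℂ‖ ≤ ‖η‖ * ‖ρ.sigma a ξ‖ := norm_inner_le_norm _ _
        _ ≤ ‖η‖ * (‖a‖ * ‖ξ‖) := by
          gcongr
          exact (ρ.sigma a).le_of_opNorm_le h1 ξ
        _ = 1 * ‖η‖ * ‖ξ‖ * ‖a‖ := by ring)

@[simp]
theorem coeffFunctional_apply {X Y : C} (η ξ : ρ.HUniv) (a : X ⟶ Y) :
    ρ.coeffFunctional X Y η ξ a = ⟪η, ρ.sigma a ξ⟫_ℂ := rfl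

/-- `τ = σ''` with values in the operators on the universal Hilbert space: `τ(F)` is the operator
with `⟪η, τ(F) ξ⟫ = ⟨F, a ↦ ⟪η, σ(a) ξ⟫⟩`, see `inner_tau`. -/
def tau {X Y : C} (F : Bidual X Y) : ρ.HUniv →L[ℂ] ρ.HUniv :=
  ContinuousLinearMap.adjoint (InnerProductSpace.continuousLinearMapOfBilin
    ((ContinuousLinearMap.compL ℂ ρ.HUniv (StrongDual ℂ (X ⟶ Y)) ℂ F) ∘SL
      ρ.coeffFunctional X Y))

theorem inner_tau {X Y : C} (F : Bidual X Y) (η ξ : ρ.HUniv) :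
    ⟪η, ρ.tau F ξ⟫_ℂ = F (ρ.coeffFunctional X Y η ξ) := by
  rw [tau, ContinuousLinearMap.adjoint_inner_right,
    InnerProductSpace.continuousLinearMapOfBilin_apply]
  rfl

/-- The Sherman-Takeda composition `G • F = τ⁻¹(τ(G) τ(F))`. -/
def stComp {X Y Z : C} (G : Bidual Y Z) (F : Bidual X Y) : Bidual X Z :=
  Function.invFun (fun H : Bidual X Z => ρ.tau H) (ρ.tau G ∘L ρ.tau F)

/-- The Sherman-Takeda bidual: the same objects, morphism spaces `(X, Y)''`, the composition
`G • F`, the identities `1̂`, and the bitransposed involution. -/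
@[reducible]
def shermanTakedaBidual : CStarCategoryStruct.{u, v} C where
  Hom X Y := Bidual X Y
  id X := hat (𝟙 X)
  comp F G := ρ.stComp G F
  normedHom X Y := inferInstanceAs (NormedAddCommGroup (Bidual X Y))
  spaceHom X Y := inferInstanceAs (NormedSpace ℂ (Bidual X Y))
  adj F := bidualAdj F

end CStarFunctor

end ShermanTakeda

end

/-! The key fact is that every bounded functional `f` on `(X, Y)` is a single coefficient `a ↦ ⟪η,
σ(a) ξ⟫` with `‖η‖ * ‖ξ‖ ≤ ‖f‖` (`Faithful.exists_coeff`). Since a faithful functor is isometric,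
`f`, normalised, is bounded by the operator norm of `ρ(a)`. A Hahn–Banach argument on 2×2 matrices
(`exists_positive_dominating`) then gives a positive functional `φ` with `φ 1 ≤ 1` and `|f(a)|² ≤
φ(ρ(a)* ρ(a))`. After normalisation of its restriction to the generated algebra, the Riesz
representation theorem in the GNS space yields the vectors.

Consequently the coefficients that define the weak operator topology and the functionals that define
the weak* topology are the same. Hence `τ` is isometric and a topological embedding, and its range
is the weak operator closure of the range of `σ`, because `(X, Y)` is weak* dense in its bidual.

Independently of faithfulness, `τ` carries the Arens composition to the product of operators
(`tau_arensComp`) and the bitransposed involution to the adjoint. Injectivity of `τ` then identifies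
the two compositions and pulls the axioms back from operators on a Hilbert space. For the positivity
axiom, the square root of `τ(H)* τ(H)` stays in the norm closed *-algebra `τ((X, X)'')`. A faithful
functor exists by a GNS construction over all objects and all positive functionals on their
endomorphisms. -/

/-! ### Dominating a functional by a positive functional. -/

section Domination

variable {B : Type*} [CStarAlgebra B] [PartialOrder B] [StarOrderedRing B]

/-- The cross terms are controlled by the positivity of `(st)⁻¹ (t x - s y)* (t x - s y)`. This is
what makes `dominationCone` closed under addition. -/
theorem star_add_mul_add_le {s t : ℝ} (hs : 0 < s) (ht : 0 < t) {x y h k : B}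
    (hx : star x * x ≤ s • h) (hy : star y * y ≤ t • k) :
    star (x + y) * (x + y) ≤ (s + t) • (h + k) := by
  have key : 0 ≤ (t / s) • (star x * x) + (s / t) • (star y * y)
      - (star x * y + star y * x) := by
    have h1 : 0 ≤ (1 / (s * t)) • (star (t • x - s • y) * (t • x - s • y)) :=
      smul_nonneg (by positivity) (star_mul_self_nonneg _)
    have h2 : (1 / (s * t)) • (star (t • x - s • y) * (t • x - s • y)) =
        (t / s) • (star x * x) + (s / t) • (star y * y) - (star x * y + star y * x) := by
      simp only [star_sub, star_smul, star_trivial, sub_mul, mul_sub, smul_mul_smul_comm,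
        smul_sub, smul_smul]
      have e1 : 1 / (s * t) * (t * t) = t / s := by field_simp
      have e2 : 1 / (s * t) * (s * s) = s / t := by field_simp
      have e3 : 1 / (s * t) * (t * s) = 1 := by field_simp
      have e4 : 1 / (s * t) * (s * t) = 1 := by field_simp
      rw [e1, e2, e3, e4, one_smul, one_smul]
      abel
    rwa [h2] at h1
  have h3 : (t / s) • (star x * x) ≤ t • h := by
    have := smul_le_smul_of_nonneg_left hx (by positivity : 0 ≤ t / s)
    rwa [smul_smul, div_mul_cancel₀ _ hs.ne'] at this
  have h4 : (s / t) • (star y * y) ≤ s • k := by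
    have := smul_le_smul_of_nonneg_left hy (by positivity : 0 ≤ s / t)
    rwa [smul_smul, div_mul_cancel₀ _ ht.ne'] at this
  calc star (x + y) * (x + y)
      = star x * x + star y * y + (star x * y + star y * x) := by
        rw [star_add, add_mul, mul_add, mul_add]; abel
    _ ≤ s • h + t • k + (t • h + s • k) :=
        add_le_add (add_le_add hx hy) ((sub_nonneg.mp key).trans (add_le_add h3 h4))
    _ = (s + t) • (h + k) := by rw [add_smul, smul_add, smul_add]; abel

variable {V : Type*} [AddCommGroup V] [Module ℂ V]

/-- The cone of all `(s, v, h)` with `(j v)* (j v) ≤ s h`, which is to say that the matrix with rows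
`s, (j v)*` and `j v, h` is positive. -/
def dominationCone (j : V →ₗ[ℂ] B) : PointedCone ℝ (ℝ × V × selfAdjoint B) where
  carrier := {p | 0 ≤ p.1 ∧ 0 ≤ (p.2.2 : B) ∧ star (j p.2.1) * j p.2.1 ≤ p.1 • (p.2.2 : B)}
  zero_mem' := by simp
  add_mem' := by
    rintro ⟨s, a, h⟩ ⟨t, b, k⟩ ⟨hs, hh, ha⟩ ⟨ht, hk, hb⟩
    simp only [Prod.fst_add, Prod.snd_add, Set.mem_ofPred_eq, map_add] at *
    refine ⟨add_nonneg hs ht, add_nonneg hh hk, ?_⟩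
    -- The estimate `star_add_mul_add_le` needs positive scalars; a zero scalar forces the
    -- corresponding vector to have zero image.
    have eq_zero : ∀ {r : ℝ} {x l : B}, r = 0 → star x * x ≤ r • l → x = 0 := by
      intro r x l hr hx
      rw [hr, zero_smul] at hx
      exact CStarRing.star_mul_self_eq_zero_iff x |>.mp (le_antisymm hx (star_mul_self_nonneg x))
    rcases hs.eq_or_lt with hs' | hs'
    · rw [eq_zero hs'.symm ha, zero_add, ← hs', zero_add]
      exact hb.trans (smul_le_smul_of_nonneg_left (le_add_of_nonneg_left hh) ht)
    rcases ht.eq_or_lt with ht' | ht'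
    · rw [eq_zero ht'.symm hb, add_zero, ← ht', add_zero]
      exact ha.trans (smul_le_smul_of_nonneg_left (le_add_of_nonneg_right hk) hs)
    exact star_add_mul_add_le hs' ht' ha hb
  smul_mem' := by
    rintro ⟨c, hc⟩ ⟨s, a, h⟩ ⟨hs, hh, ha⟩
    refine ⟨mul_nonneg hc hs, smul_nonneg hc hh, ?_⟩
    change star (j (c • a)) * j (c • a) ≤ (c * s) • (c • (h : B))
    have h1 : j (c • a) = c • j a := map_smul (j.restrictScalars ℝ) c a
    rw [h1, star_smul, smul_mul_smul_comm, star_trivial, smul_smul, mul_right_comm, mul_smul (c * c)]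
    exact smul_le_smul_of_nonneg_left ha (mul_nonneg hc hc)

/-- A real functional on the self-adjoint part that is positive is the restriction of a positive
functional. -/
theorem exists_positive_of_selfAdjoint (φ : selfAdjoint B →ₗ[ℝ] ℝ)
    (hφ : ∀ h : selfAdjoint B, 0 ≤ (h : B) → 0 ≤ φ h) :
    ∃ ψ : B →ₚ[ℂ] ℂ, ∀ h : selfAdjoint B, ψ (h : B) = φ h := by
  let fr : B →ₗ[ℝ] ℝ := φ ∘ₗ realPart
  let ψ : B →ₗ[ℂ] ℂ := Module.Dual.extendRCLike (𝕜 := ℂ) fr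
  have key : ∀ h : selfAdjoint B, ψ (h : B) = φ h := by
    intro h
    have h1 : realPart (h : B) = h := Subtype.ext (IsSelfAdjoint.coe_realPart h.2)
    have h2 : realPart (Complex.I • (h : B)) = 0 := by
      rw [realPart_I_smul, h.2.imaginaryPart, neg_zero]
    change Module.Dual.extendRCLike (𝕜 := ℂ) fr (h : B) = _
    rw [Module.Dual.extendRCLike_apply]
    simp [fr, h1, h2]
  refine ⟨PositiveLinearMap.mk₀ ψ fun a ha => ?_, key⟩
  have := key ⟨a, IsSelfAdjoint.of_nonneg ha⟩
  change ψ a = _ at this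
  rw [this]
  exact_mod_cast hφ _ ha

/-- The functional `(s, v, t) ↦ s + 2 Re f(v) + t`, defined where the last entry is the scalar `t •
1`, is nonnegative on the cone of positive matrices, so the M. Riesz theorem extends it to a
positive functional. Its restriction to the last entry is the desired `φ`. -/
theorem exists_positive_dominating (j : V →ₗ[ℂ] B) (f : V →ₗ[ℂ] ℂ) (hf : ∀ v, ‖f v‖ ≤ ‖j v‖) :
    ∃ φ : B →ₚ[ℂ] ℂ, φ 1 ≤ 1 ∧ ∀ v, ‖f v‖ ^ 2 ≤ (φ (star (j v) * j v)).re := by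
  -- In the zero algebra `1 = 0`, so `t` could not be recovered from `t • 1`.
  rcases subsingleton_or_nontrivial B with hB | hB
  · refine ⟨0, by simp, fun v => ?_⟩
    have := hf v
    rw [Subsingleton.elim (j v) 0, norm_zero] at this
    simp [le_antisymm this (norm_nonneg _)]
  let one' : selfAdjoint B := 1
  let e : ℝ × V × ℝ →ₗ[ℝ] ℝ × V × selfAdjoint B :=
    LinearMap.prodMap LinearMap.id (LinearMap.prodMap LinearMap.id
      (LinearMap.toSpanSingleton ℝ (selfAdjoint B) one'))
  have he : ∀ s v t, e (s, v, t) = (s, v, t • one') := fun s v t => rfl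
  have hinj : Function.Injective e := by
    rintro ⟨s, v, t⟩ ⟨s', v', t'⟩ h
    rw [he, he, Prod.mk.injEq, Prod.mk.injEq] at h
    obtain ⟨rfl, rfl, h⟩ := h
    have h1 : t • (1 : B) = t' • (1 : B) := congrArg Subtype.val h
    rw [smul_left_injective ℝ (one_ne_zero (α := B)) h1]
  let f₀ : ℝ × V × ℝ →ₗ[ℝ] ℝ :=
    LinearMap.coprod LinearMap.id (LinearMap.coprod
      ((2 : ℝ) • Complex.reLm ∘ₗ f.restrictScalars ℝ) LinearMap.id)
  have hf₀ : ∀ s v t, f₀ (s, v, t) = s + (2 * (f v).re + t) := fun s v t => rfl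
  let fp : (ℝ × V × selfAdjoint B) →ₗ.[ℝ] ℝ :=
    ⟨LinearMap.range e, f₀ ∘ₗ (LinearEquiv.ofInjective e hinj).symm⟩
  have hfp : ∀ x (hx : e x ∈ LinearMap.range e), fp ⟨e x, hx⟩ = f₀ x := by
    intro x hx
    change f₀ ((LinearEquiv.ofInjective e hinj).symm ⟨e x, hx⟩) = _
    congr 1
    rw [LinearEquiv.symm_apply_eq]
    rfl
  obtain ⟨g, hg, hpos⟩ := riesz_extension (dominationCone j) fp (by
    -- Membership in the cone gives `‖j v‖² ≤ s t`, hence `|f v| ≤ √(s t) ≤ (s + t) / 2`.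
    rintro ⟨_, ⟨s, v, t⟩, rfl⟩ ⟨hs, ht, hv⟩
    refine (?_ : 0 ≤ f₀ (s, v, t)).trans_eq (hfp _ _).symm
    rw [hf₀]
    change 0 ≤ t • (1 : B) at ht
    change 0 ≤ s at hs
    change star (j v) * j v ≤ s • t • (1 : B) at hv
    have ht' : 0 ≤ t := by
      by_contra hlt
      have h1 : 0 ≤ (-t)⁻¹ • t • (1 : B) := smul_nonneg (inv_nonneg.mpr (by linarith)) ht
      rw [smul_smul, show (-t)⁻¹ * t = -1 by
        rw [inv_neg, neg_mul, inv_mul_cancel₀ (by linarith)], neg_smul, one_smul] at h1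
      exact one_ne_zero (α := B) (le_antisymm (neg_nonneg.mp h1) zero_le_one)
    have h2 : ‖j v‖ ^ 2 ≤ s * t := by
      have := CStarAlgebra.norm_le_norm_of_nonneg_of_le (star_mul_self_nonneg (j v)) hv
      rw [CStarRing.norm_star_mul_self, smul_smul, norm_smul, norm_one, mul_one,
        Real.norm_of_nonneg (mul_nonneg hs ht')] at this
      rwa [sq]
    have h3 : ‖f v‖ ^ 2 ≤ s * t := (pow_le_pow_left₀ (norm_nonneg _) (hf v) 2).trans h2
    have h4 : |(f v).re| ≤ ‖f v‖ := Complex.abs_re_le_norm _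
    have h5 : ‖f v‖ ≤ (s + t) / 2 := by
      refine abs_le_of_sq_le_sq' ?_ (by positivity) |>.2
      nlinarith [sq_nonneg (s - t)]
    have := neg_abs_le (f v).re
    linarith) (by
    -- Every vector is moved into the cone by the domain: the sum is `(1, 0, ‖h‖ • 1 + h)`, and `h ≥
    -- -‖h‖ • 1`.
    rintro ⟨s, v, h⟩
    refine ⟨⟨e (1 - s, -v, ‖(h : B)‖), LinearMap.mem_range_self _ _⟩, ?_⟩
    change e (1 - s, -v, ‖(h : B)‖) + (s, v, h) ∈ _
    rw [he]
    have h1 : 0 ≤ ‖(h : B)‖ • (1 : B) + (h : B) := by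
      have := h.2.neg_algebraMap_norm_le_self
      rw [Algebra.algebraMap_eq_smul_one] at this
      exact neg_le_iff_add_nonneg'.mp this
    refine ⟨?_, h1, ?_⟩
    · simp
    · simpa [one'] using h1)
  let φr : selfAdjoint B →ₗ[ℝ] ℝ :=
    g ∘ₗ LinearMap.inr ℝ ℝ (V × selfAdjoint B) ∘ₗ LinearMap.inr ℝ V (selfAdjoint B)
  have hφr : ∀ h, φr h = g (0, 0, h) := fun h => rfl
  obtain ⟨φ, hφ⟩ := exists_positive_of_selfAdjoint φr (fun h hh => by
    rw [hφr]
    exact hpos _ ⟨le_rfl, hh, by simp⟩)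
  refine ⟨φ, ?_, fun v => ?_⟩
  · have h1 := hφ 1
    have h2 := hg ⟨e (0, 0, 1), LinearMap.mem_range_self _ _⟩
    rw [hfp, hf₀] at h2
    have h3 : g (0, 0, 1) = 1 := by
      simpa [he, one'] using h2
    rw [hφr, h3] at h1
    simpa using h1.le
  · let P : selfAdjoint B := ⟨star (j v) * j v, IsSelfAdjoint.star_mul_self _⟩
    have hP : φ (star (j v) * j v) = φr P := hφ P
    rw [hP, Complex.ofReal_re]
    -- The triple `(1, c • v, |c|² • P)` lies on the boundary of the cone, where its defining
    -- inequality is an equality.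
    have key : ∀ c : ℂ, 0 ≤ 1 + 2 * (c * f v).re + ‖c‖ ^ 2 * φr P := by
      intro c
      have h1 : 0 ≤ g (1, c • v, ‖c‖ ^ 2 • P) := by
        refine hpos _ ⟨zero_le_one, smul_nonneg (by positivity) (star_mul_self_nonneg _), ?_⟩
        change star (j (c • v)) * j (c • v) ≤ (1 : ℝ) • ‖c‖ ^ 2 • (star (j v) * j v)
        rw [one_smul, map_smul, star_smul, smul_mul_smul_comm,
          ← Complex.coe_smul, Complex.ofReal_pow, ← Complex.conj_mul']
        exact le_rfl
      have h2 := hg ⟨e (1, c • v, 0), LinearMap.mem_range_self _ _⟩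
      rw [hfp, hf₀] at h2
      have h3 : ((1 : ℝ), c • v, ‖c‖ ^ 2 • P) = e (1, c • v, 0) + (0, 0, ‖c‖ ^ 2 • P) := by
        simp [he]
      rw [h3, map_add, ← hφr, map_smul] at h1
      rw [h2, map_smul, smul_eq_mul, smul_eq_mul] at h1
      linarith
    -- With `c = r * conj (f v)` and `r` real, `key` is a nonnegative quadratic in `r`; its
    -- discriminant gives the bound after division by `‖f v‖²`.
    have h4 : discrim (‖f v‖ ^ 2 * φr P) (2 * ‖f v‖ ^ 2) 1 ≤ 0 := by
      refine discrim_le_zero fun r => ?_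
      have h5 := key (r * star (f v))
      have h6 : (r * star (f v) * f v).re = r * ‖f v‖ ^ 2 := by
        rw [mul_assoc, Complex.star_def, Complex.conj_mul', ← Complex.ofReal_pow,
          ← Complex.ofReal_mul, Complex.ofReal_re]
      rw [h6, norm_mul, norm_star, Complex.norm_real, mul_pow, Real.norm_eq_abs, sq_abs] at h5
      nlinarith
    rw [discrim] at h4
    by_cases h0 : ‖f v‖ = 0
    · rw [h0, hφr]
      simpa using hpos _ (show ((0 : ℝ), (0 : V), P) ∈ dominationCone j from
        ⟨le_rfl, star_mul_self_nonneg _, by simp⟩)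
    · have : 0 < ‖f v‖ ^ 2 := by positivity
      nlinarith

/-- Cauchy–Schwarz for the vectors of `1` and `a` in the GNS inner product. -/
theorem PositiveLinearMap.norm_apply_sq_le (φ : B →ₚ[ℂ] ℂ) (h1 : φ 1 ≤ 1) (a : B) :
    ‖φ a‖ ^ 2 ≤ (φ (star a * a)).re := by
  have h := norm_inner_le_norm (𝕜 := ℂ) (φ.toPreGNS 1) (φ.toPreGNS a)
  rw [PositiveLinearMap.preGNS_inner_def, PositiveLinearMap.preGNS_norm_def,
    PositiveLinearMap.preGNS_norm_def] at h
  simp only [PositiveLinearMap.ofPreGNS_toPreGNS, star_one, one_mul] at h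
  have h2 : √(φ 1).re ≤ 1 := Real.sqrt_le_one.mpr (Complex.le_def.mp h1).1
  have h3 : 0 ≤ (φ (star a * a)).re :=
    (Complex.le_def.mp (φ.map_nonneg (star_mul_self_nonneg a))).1
  have h4 : ‖φ a‖ ≤ √(φ (star a * a)).re :=
    h.trans (mul_le_of_le_one_left (Real.sqrt_nonneg _) h2)
  exact (pow_le_pow_left₀ (norm_nonneg _) h4 2).trans_eq (Real.sq_sqrt h3)

end Domination

/-! ### Functionals as coefficients of the universal representation. -/

/-- The bound makes `g` factor through the range of `T` as a functional of norm at most `c`.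
Hahn–Banach extends it to `H` with the same norm, and the Riesz representation theorem supplies `η`.
-/
theorem exists_inner_eq_of_norm_le {V H : Type*} [AddCommGroup V] [Module ℂ V]
    [NormedAddCommGroup H] [InnerProductSpace ℂ H] [CompleteSpace H] (T : V →ₗ[ℂ] H)
    (g : V →ₗ[ℂ] ℂ) {c : ℝ} (hc : 0 ≤ c) (hg : ∀ v, ‖g v‖ ≤ c * ‖T v‖) :
    ∃ η : H, ‖η‖ ≤ c ∧ ∀ v, g v = ⟪η, T v⟫_ℂ := by
  have hker : LinearMap.ker T ≤ LinearMap.ker g := fun v hv => by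
    have := hg v
    rw [LinearMap.mem_ker.mp hv, norm_zero, mul_zero] at this
    exact norm_le_zero_iff.mp this
  let g₀ : LinearMap.range T →ₗ[ℂ] ℂ :=
    (LinearMap.ker T).liftQ g hker ∘ₗ T.quotKerEquivRange.symm
  have hg₀ : ∀ v (h : T v ∈ LinearMap.range T), g₀ ⟨T v, h⟩ = g v := fun v h => by
    have : T.quotKerEquivRange.symm ⟨T v, h⟩ = (LinearMap.ker T).mkQ v := by
      rw [LinearEquiv.symm_apply_eq]
      rfl
    change (LinearMap.ker T).liftQ g hker (T.quotKerEquivRange.symm ⟨T v, h⟩) = _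
    rw [this]
    rfl
  let g₁ : StrongDual ℂ (LinearMap.range T) := g₀.mkContinuous c (by
    rintro ⟨_, v, rfl⟩
    exact (congrArg norm (hg₀ v _)).trans_le (hg v))
  obtain ⟨G, hG, hGn⟩ := exists_extension_norm_eq (LinearMap.range T) g₁
  refine ⟨(InnerProductSpace.toDual ℂ H).symm G, ?_, fun v => ?_⟩
  · rw [LinearIsometryEquiv.norm_map, hGn]
    exact LinearMap.mkContinuous_norm_le _ hc _
  · rw [InnerProductSpace.toDual_symm_apply]
    exact ((hG ⟨T v, LinearMap.mem_range_self T v⟩).trans (hg₀ v _)).symm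

section Universal

variable {A : Type u} [NonUnitalCStarAlgebra A] [PartialOrder A] [StarOrderedRing A]

namespace PositiveLinearMap

/-- The canonical map from a C*-algebra to the GNS space of a positive functional. -/
noncomputable def toGNS (ψ : A →ₚ[ℂ] ℂ) : A →ₗ[ℂ] ψ.GNS :=
  (UniformSpace.Completion.toComplL (𝕜 := ℂ) (E := ψ.PreGNS)).toLinearMap ∘ₗ
    ψ.toPreGNS.toLinearMap

theorem toGNS_apply (ψ : A →ₚ[ℂ] ℂ) (a : A) :
    ψ.toGNS a = ((ψ.toPreGNS a : ψ.PreGNS) : ψ.GNS) := rfl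

theorem inner_toGNS (ψ : A →ₚ[ℂ] ℂ) (a b : A) :
    ⟪ψ.toGNS a, ψ.toGNS b⟫_ℂ = ψ (star a * b) := by
  rw [toGNS_apply, toGNS_apply, UniformSpace.Completion.inner_coe, preGNS_inner_def]
  rfl

theorem norm_toGNS_sq (ψ : A →ₚ[ℂ] ℂ) (a : A) : ‖ψ.toGNS a‖ ^ 2 = (ψ (star a * a)).re := by
  rw [← inner_toGNS, ← inner_self_eq_norm_sq (𝕜 := ℂ)]
  rfl

theorem gns_toGNS (ψ : A →ₚ[ℂ] ℂ) (a b : A) :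
    ψ.gnsNonUnitalStarAlgHom a (ψ.toGNS b) = ψ.toGNS (a * b) := by
  rw [toGNS_apply, gnsNonUnitalStarAlgHom_apply_coe]
  rfl

theorem denseRange_toGNS (ψ : A →ₚ[ℂ] ℂ) : DenseRange ψ.toGNS :=
  UniformSpace.Completion.denseRange_coe.comp ψ.toPreGNS.surjective.denseRange
    (UniformSpace.Completion.continuous_coe _)

/-- A vector representing a positive functional as `⟪ξ, ·⟫` is cyclic. -/
theorem gns_apply_eq_toGNS (ψ : A →ₚ[ℂ] ℂ) {ξ : ψ.GNS} (hξ : ∀ a, ψ a = ⟪ξ, ψ.toGNS a⟫_ℂ) (a : A) :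
    ψ.gnsNonUnitalStarAlgHom a ξ = ψ.toGNS a := by
  refine ψ.denseRange_toGNS.eq_of_inner_left ℂ fun b => ?_
  have h : ContinuousLinearMap.adjoint (ψ.gnsNonUnitalStarAlgHom (star a)) =
      ψ.gnsNonUnitalStarAlgHom a := by
    rw [← ContinuousLinearMap.star_eq_adjoint, ← map_star, star_star]
  rw [← h, ContinuousLinearMap.adjoint_inner_left, gns_toGNS, ← hξ, inner_toGNS]

end PositiveLinearMap

theorem univRep_apply (a : A) (x : UnivSpace A) (φ : CStarState A) :
    univRep A a x φ = φ.toPositive.gnsNonUnitalStarAlgHom a (x φ) := rfl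

open Classical in
-- Both vectors live in the single summand of `ψ`. The first bound gives `ξ` with `ψ(a) = ⟪ξ, [a]⟫`,
-- which replaces the class of a unit since `π(a) ξ = [a]`; the second gives `η` with `g(v) = ⟪η, [k
-- v]⟫`. The factors `√m⁻¹` and `√m` cancel in the product of the norms.
theorem CStarState.exists_coeff (ψ : CStarState A) {V : Type*} [AddCommGroup V] [Module ℂ V]
    (k : V →ₗ[ℂ] A) (g : V →ₗ[ℂ] ℂ) {m : ℝ} (hm : 0 < m)
    (hψ : ∀ a, ‖ψ.toPositive a‖ ^ 2 ≤ m⁻¹ * (ψ.toPositive (star a * a)).re)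
    (hg : ∀ v, ‖g v‖ ^ 2 ≤ m * (ψ.toPositive (star (k v) * k v)).re) :
    ∃ η ξ : UnivSpace A, ‖η‖ * ‖ξ‖ ≤ 1 ∧ ∀ v, g v = ⟪η, univRep A (k v) ξ⟫_ℂ := by
  have bound : ∀ {x y c : ℝ}, 0 ≤ y → 0 ≤ c → x ^ 2 ≤ c * y ^ 2 → x ≤ √c * y := by
    intro x y c hy hc h
    refine abs_le_of_sq_le_sq' ?_ (by positivity) |>.2
    rwa [mul_pow, Real.sq_sqrt hc]
  obtain ⟨ξ, hξn, hξ⟩ := exists_inner_eq_of_norm_le ψ.toPositive.toGNS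
    (ψ.toPositive : A →ₗ[ℂ] ℂ) (Real.sqrt_nonneg m⁻¹) (fun a =>
      bound (norm_nonneg _) (inv_nonneg.mpr hm.le) (by
        rw [PositiveLinearMap.norm_toGNS_sq]
        exact hψ a))
  obtain ⟨η, hηn, hη⟩ := exists_inner_eq_of_norm_le (ψ.toPositive.toGNS ∘ₗ k) g
    (Real.sqrt_nonneg m) (fun v => bound (norm_nonneg _) hm.le (by
        rw [LinearMap.comp_apply, PositiveLinearMap.norm_toGNS_sq]
        exact hg v))
  refine ⟨lp.single 2 ψ η, lp.single 2 ψ ξ, ?_, fun v => ?_⟩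
  · rw [lp.norm_single (by norm_num), lp.norm_single (by norm_num)]
    calc ‖η‖ * ‖ξ‖ ≤ √m * √m⁻¹ := by gcongr
      _ = 1 := by rw [← Real.sqrt_mul hm.le, mul_inv_cancel₀ hm.ne', Real.sqrt_one]
  · rw [lp.inner_single_left, univRep_apply, lp.single_apply_self,
      PositiveLinearMap.gns_apply_eq_toGNS _ hξ, hη]
    rfl

/-- The universal representation sums over functionals of norm exactly one, so `φ` is divided by its
norm `m`; this is the `m` of `CStarState.exists_coeff`. If `φ = 0`, then `g = 0`. -/
theorem exists_univRep_coeff (φ : A →ₚ[ℂ] ℂ) (hφ : ∀ a, ‖φ a‖ ^ 2 ≤ (φ (star a * a)).re)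
    (hφ' : ∀ a, ‖φ a‖ ≤ ‖a‖)
    {V : Type*} [AddCommGroup V] [Module ℂ V] (k : V →ₗ[ℂ] A) (g : V →ₗ[ℂ] ℂ)
    (hg : ∀ v, ‖g v‖ ^ 2 ≤ (φ (star (k v) * k v)).re) :
    ∃ η ξ : UnivSpace A, ‖η‖ * ‖ξ‖ ≤ 1 ∧ ∀ v, g v = ⟪η, univRep A (k v) ξ⟫_ℂ := by
  let φL : StrongDual ℂ A := (φ : A →ₗ[ℂ] ℂ).mkContinuous 1 (fun a => by
    rw [one_mul]; exact hφ' a)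
  have hφL : ∀ a, φL a = φ a := fun a => rfl
  rcases eq_or_ne φL 0 with h0 | h0
  · refine ⟨0, 0, by simp, fun v => ?_⟩
    have h1 := hg v
    rw [← hφL, h0] at h1
    have h2 : ‖g v‖ ^ 2 ≤ 0 := h1
    rw [inner_zero_left, ← norm_le_zero_iff]
    exact (pow_eq_zero_iff two_ne_zero).mp (le_antisymm h2 (sq_nonneg _)) |>.le
  have hm : 0 < ‖φL‖ := norm_pos_iff.mpr h0
  let ψ : CStarState A := ⟨((‖φL‖⁻¹ : ℝ) : ℂ) • φL, fun a ha =>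
      mul_nonneg (by exact_mod_cast inv_nonneg.mpr hm.le) (φ.map_nonneg ha), by
    rw [norm_smul, Complex.norm_real, norm_inv, norm_norm, inv_mul_cancel₀ hm.ne']⟩
  have hψ : ∀ a, ψ.toPositive a = ((‖φL‖⁻¹ : ℝ) : ℂ) * φ a := fun a => rfl
  have hre : ∀ a, (ψ.toPositive a).re = ‖φL‖⁻¹ * (φ a).re := fun a => by
    rw [hψ, Complex.re_ofReal_mul]
  refine ψ.exists_coeff k g hm (fun a => ?_) (fun v => ?_)
  · rw [hre, hψ, norm_mul, Complex.norm_real, mul_pow, ← mul_assoc, ← sq, norm_inv, norm_norm]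
    gcongr
    exact hφ a
  · rw [hre, mul_inv_cancel_left₀ hm.ne']
    exact hg v

/-- A functional bounded by the norm of a C*-algebra `A` of operators is a single coefficient of
the universal representation of `A`. -/
theorem exists_univRep_coeff_of_norm_le {B : Type*} [CStarAlgebra B] [PartialOrder B]
    [StarOrderedRing B] (i : A →⋆ₙₐ[ℂ] B) {V : Type*} [AddCommGroup V] [Module ℂ V]
    (k : V →ₗ[ℂ] A) (g : V →ₗ[ℂ] ℂ) (hg : ∀ v, ‖g v‖ ≤ ‖i (k v)‖) :
    ∃ η ξ : UnivSpace A, ‖η‖ * ‖ξ‖ ≤ 1 ∧ ∀ v, g v = ⟪η, univRep A (k v) ξ⟫_ℂ := by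
  -- The domination takes place in the unital algebra `B`, because `A` may have no unit; only the
  -- restriction of `φ` to `A` is used afterwards.
  obtain ⟨φ, h1, hφ⟩ := exists_positive_dominating ((i : A →ₗ[ℂ] B) ∘ₗ k) g hg
  let φA : A →ₚ[ℂ] ℂ := PositiveLinearMap.mk₀ ((φ : B →ₗ[ℂ] ℂ) ∘ₗ (i : A →ₗ[ℂ] B))
    fun a ha => φ.map_nonneg (map_nonneg i ha)
  have hA : ∀ a, φA a = φ (i a) := fun a => rfl
  refine exists_univRep_coeff φA (fun a => ?_) (fun a => ?_) k g (fun v => ?_)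
  · rw [hA, hA, map_mul, map_star]
    exact φ.norm_apply_sq_le h1 (i a)
  · have h2 := φ.norm_apply_sq_le h1 (i a)
    have h3 := φ.norm_apply_le_of_nonneg _ (star_mul_self_nonneg (i a))
    have h4 : ‖φ 1‖ ≤ 1 := by
      have h5 : 0 ≤ φ 1 := φ.map_nonneg zero_le_one
      simpa using CStarAlgebra.norm_le_norm_of_nonneg_of_le h5 h1
    rw [CStarRing.norm_star_mul_self] at h3
    have h6 : ‖φ (i a)‖ ^ 2 ≤ ‖i a‖ ^ 2 := h2.trans <| (Complex.re_le_norm _).trans <| by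
      rw [sq]
      exact h3.trans (mul_le_of_le_one_left (by positivity) h4)
    exact (le_of_sq_le_sq h6 (norm_nonneg _)).trans (NonUnitalStarAlgHom.norm_apply_le i a)
  · rw [hA, map_mul, map_star]
    exact hφ v

end Universal

/-! ### Approximation of bidual elements by point evaluations. -/

section DoubleDual

variable {E : Type*} [NormedAddCommGroup E] [NormedSpace ℂ E]

/-- On finitely many functionals, an element of the bidual agrees with a point evaluation. -/
theorem exists_forall_mem_finset_eq (F : StrongDual ℂ (StrongDual ℂ E))
    (s : Finset (StrongDual ℂ E)) : ∃ x : E, ∀ f ∈ s, f x = F f := by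
  classical
  let ev : E →ₗ[ℂ] (s → ℂ) := LinearMap.pi fun f => (f.1 : E →ₗ[ℂ] ℂ)
  by_contra hne
  have hmem : (fun f : s => F f.1) ∉ LinearMap.range ev := by
    rintro ⟨x, hx⟩
    exact hne ⟨x, fun f hf => congrFun hx ⟨f, hf⟩⟩
  -- A functional `l` separating the values of `F` from the range of `ev` is a linear relation among
  -- the members of `s`; applying `F` to that relation gives a contradiction.
  obtain ⟨l, hl, hl'⟩ := Submodule.exists_le_ker_of_notMem hmem
  have hsum : ∀ y : s → ℂ, l y = ∑ f, l (Pi.single f 1) * y f := fun y => by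
    conv_lhs => rw [pi_eq_sum_univ' y, map_sum]
    refine Finset.sum_congr rfl fun f _ => ?_
    rw [map_smul, smul_eq_mul, mul_comm]
  have h0 : ∑ f : s, l (Pi.single f 1) • f.1 = 0 := by
    ext x
    have h1 : l (ev x) = 0 := hl' ⟨x, rfl⟩
    rw [hsum] at h1
    simpa [ev] using h1
  refine hl ?_
  rw [hsum]
  have := congrArg F h0
  simpa using this

/-- A basic weak* neighbourhood constrains only finitely many functionals, and on these `F` agrees
exactly with a point evaluation. -/
theorem denseRange_toWeakDual_inclusionInDoubleDual :
    DenseRange fun x : E =>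
      StrongDual.toWeakDual (NormedSpace.inclusionInDoubleDual ℂ E x) := by
  intro F
  refine mem_closure_iff.mpr fun U hU hF => ?_
  obtain ⟨V, hV, rfl⟩ := isOpen_induced_iff.mp hU
  obtain ⟨s, u, hu, hs⟩ := isOpen_pi_iff.mp hV _ hF
  obtain ⟨x, hx⟩ := exists_forall_mem_finset_eq (WeakDual.toStrongDual F) s
  refine ⟨_, hs fun f hf => ?_, x, rfl⟩
  have h : f x ∈ u f := by
    rw [hx f hf]
    exact (hu f hf).2
  exact h

/-- A pointwise limit of point evaluations that is bounded belongs to the bidual. -/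
theorem exists_bidual_of_tendsto {l : Filter E} [l.NeBot] {r : StrongDual ℂ E → ℂ}
    (hr : ∀ f : StrongDual ℂ E, Filter.Tendsto (fun a => f a) l (nhds (r f))) {M : ℝ}
    (hM : ∀ f, ‖r f‖ ≤ M * ‖f‖) :
    ∃ F : StrongDual ℂ (StrongDual ℂ E), ∀ f, F f = r f :=
  ⟨LinearMap.mkContinuous
    { toFun := r
      map_add' := fun f g => tendsto_nhds_unique (hr (f + g)) ((hr f).add (hr g))
      map_smul' := fun c f => tendsto_nhds_unique (hr (c • f)) ((hr f).const_smul c) } M hM,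
    fun _ => rfl⟩

end DoubleDual

/-! ### The representation `σ` and its bitranspose `τ`. -/

section Representation

open CStarCategoryStruct (adj)

variable {C : Type u} [CStarCategoryStruct.{u, v} C]

namespace CStarFunctor

variable (ρ : CStarFunctor C HilbSp.{w})

open Classical in
theorem block_apply (X Y : C) (T : ρ.obj X →L[ℂ] ρ.obj Y) (x : ρ.TotalSpace) :
    ρ.block X Y T x = lp.single 2 Y (T (x X)) := rfl

open Classical in
theorem norm_block (X Y : C) (T : ρ.obj X →L[ℂ] ρ.obj Y) : ‖ρ.block X Y T‖ = ‖T‖ := by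
  refine le_antisymm (ρ.norm_block_le X Y T) (T.opNorm_le_bound (norm_nonneg _) fun x => ?_)
  have h := (ρ.block X Y T).le_opNorm (lp.single 2 X x)
  rwa [block_apply, lp.single_apply_self, lp.norm_single (by norm_num),
    lp.norm_single (by norm_num)] at h

theorem block_comp (X Y Z : C) (S : ρ.obj X →L[ℂ] ρ.obj Y) (T : ρ.obj Y →L[ℂ] ρ.obj Z) :
    ρ.block X Z (T ∘L S) = ρ.block Y Z T * ρ.block X Y S := by
  classical
  ext1 x
  rw [mul_apply_eq_comp, block_apply, block_apply, block_apply,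
    lp.single_apply_self]
  rfl

theorem block_adjoint (X Y : C) (T : ρ.obj X →L[ℂ] ρ.obj Y) :
    ρ.block Y X (ContinuousLinearMap.adjoint T) = star (ρ.block X Y T) := by
  classical
  rw [ContinuousLinearMap.star_eq_adjoint, ContinuousLinearMap.eq_adjoint_iff]
  intro x y
  rw [block_apply, block_apply, lp.inner_single_left, lp.inner_single_right,
    ContinuousLinearMap.adjoint_inner_left]

theorem toGen_comp {X Y Z : C} (a : X ⟶ Y) (b : Y ⟶ Z) :
    ρ.toGen (a ≫ b) = ρ.toGen b * ρ.toGen a := by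
  refine Subtype.ext ?_
  have h : ρ.op (a ≫ b) = ρ.op b ∘L ρ.op a := ρ.map_comp a b
  change ρ.block X Z (ρ.op (a ≫ b)) = ρ.block Y Z (ρ.op b) * ρ.block X Y (ρ.op a)
  rw [h, block_comp]

theorem toGen_adj {X Y : C} (a : X ⟶ Y) : ρ.toGen (adj a) = star (ρ.toGen a) := by
  refine Subtype.ext ?_
  have h : ρ.op (adj a) = ContinuousLinearMap.adjoint (ρ.op a) := ρ.map_adj a
  change ρ.block Y X (ρ.op (adj a)) = star (ρ.block X Y (ρ.op a))
  rw [h, block_adjoint]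

/-- The inclusion of the generated C*-algebra into the operators on the Hilbert sum. -/
noncomputable def genInclusion : ρ.GenAlgebra →⋆ₙₐ[ℂ] (ρ.TotalSpace →L[ℂ] ρ.TotalSpace) :=
  NonUnitalStarSubalgebraClass.subtype ρ.genSubalgebra

/-- `a ↦ ρ(a)` as a linear map into the generated C*-algebra. -/
noncomputable def toGenₗ (X Y : C) : (X ⟶ Y) →ₗ[ℂ] ρ.GenAlgebra where
  toFun := ρ.toGen
  map_add' := ρ.toGen_add
  map_smul' := ρ.toGen_smul

variable [IsCStarCategory C]

open IsCStarCategory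

theorem sigma_comp {X Y Z : C} (a : X ⟶ Y) (b : Y ⟶ Z) :
    ρ.sigma (a ≫ b) = ρ.sigma b ∘L ρ.sigma a := by
  rw [sigma_apply, toGen_comp, map_mul]
  rfl

theorem sigma_adj {X Y : C} (a : X ⟶ Y) :
    ρ.sigma (adj a) = ContinuousLinearMap.adjoint (ρ.sigma a) := by
  rw [sigma_apply, toGen_adj, map_star]
  rfl

variable {ρ} in
-- On `(X, X)` an injective *-homomorphism of C*-algebras is isometric; the C*-identity transfers
-- this to `(X, Y)` through `a* a`.
theorem Faithful.norm_op (hρ : ρ.Faithful) {X Y : C} (a : X ⟶ Y) : ‖ρ.op a‖ = ‖a‖ := by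
  let _ := endCStarAlgebra X
  let φ : (X ⟶ X) →⋆ₙₐ[ℂ] (ρ.obj X →L[ℂ] ρ.obj X) :=
    { toFun := fun b => ρ.op b
      map_smul' := fun c b => map_smul ρ.map c b
      map_zero' := map_zero ρ.map
      map_add' := fun b c => map_add ρ.map b c
      map_mul' := fun b c => ρ.map_comp c b
      map_star' := fun b => ρ.map_adj b }
  have h1 : ‖ρ.op (a ≫ adj a)‖ = ‖a ≫ adj a‖ :=
    NonUnitalStarAlgHom.norm_map (B := ρ.obj X →L[ℂ] ρ.obj X) φ (hρ X X) (a ≫ adj a)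
  have h2 : ρ.op (a ≫ adj a) = ContinuousLinearMap.adjoint (ρ.op a) ∘L ρ.op a := by
    change ρ.map (a ≫ adj a) = _
    rw [ρ.map_comp, ρ.map_adj]
    rfl
  rw [h2, ContinuousLinearMap.norm_adjoint_comp_self, ← norm_sq, ← sq] at h1
  exact (pow_left_inj₀ (norm_nonneg _) (norm_nonneg _) two_ne_zero).mp h1

variable {ρ} in
/-- Every bounded functional on `(X, Y)` is a single coefficient of `σ`, with norm control. -/
theorem Faithful.exists_coeff (hρ : ρ.Faithful) {X Y : C} (f : StrongDual ℂ (X ⟶ Y)) :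
    ∃ η ξ : ρ.HUniv, ‖η‖ * ‖ξ‖ ≤ ‖f‖ ∧ ρ.coeffFunctional X Y η ξ = f := by
  rcases eq_or_ne f 0 with rfl | hf
  · exact ⟨0, 0, by simp, by simp⟩
  have hm : 0 < ‖f‖ := norm_pos_iff.mpr hf
  have hm' : (‖f‖ : ℂ) ≠ 0 := by exact_mod_cast hm.ne'
  -- The normalised functional is bounded by `‖a‖`, which is the norm of the matrix entry `ρ(a)` by
  -- faithfulness.
  obtain ⟨η, ξ, hn, h⟩ := exists_univRep_coeff_of_norm_le ρ.genInclusion (ρ.toGenₗ X Y)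
    (((‖f‖ : ℂ)⁻¹ • f : StrongDual ℂ (X ⟶ Y)) : (X ⟶ Y) →ₗ[ℂ] ℂ) (fun a => by
      change ‖(‖f‖ : ℂ)⁻¹ * f a‖ ≤ ‖ρ.block X Y (ρ.op a)‖
      rw [norm_block, hρ.norm_op, norm_mul, norm_inv, Complex.norm_real, norm_norm]
      exact inv_mul_le_of_le_mul₀ hm.le (norm_nonneg _) (f.le_opNorm a))
  refine ⟨η, (‖f‖ : ℂ) • ξ, ?_, ?_⟩
  · rw [norm_smul, Complex.norm_real, norm_norm, mul_left_comm]
    exact mul_le_of_le_one_right hm.le hn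
  · ext a
    have h1 : (‖f‖ : ℂ)⁻¹ * f a = ⟪η, ρ.sigma a ξ⟫_ℂ := h a
    rw [coeffFunctional_apply, map_smul, inner_smul_right, ← h1, mul_inv_cancel_left₀ hm']

theorem norm_coeffFunctional_le {X Y : C} (η ξ : ρ.HUniv) :
    ‖ρ.coeffFunctional X Y η ξ‖ ≤ ‖η‖ * ‖ξ‖ :=
  ((ρ.coeffFunctional X Y).le_opNorm₂ η ξ).trans (by
    gcongr
    exact mul_le_of_le_one_left (norm_nonneg η) (LinearMap.mkContinuous₂_norm_le _ zero_le_one _))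

theorem tau_eq_of_inner {X Y : C} {F : Bidual X Y} {T : ρ.HUniv →L[ℂ] ρ.HUniv}
    (h : ∀ η ξ, F (ρ.coeffFunctional X Y η ξ) = ⟪η, T ξ⟫_ℂ) : ρ.tau F = T := by
  ext1 ξ
  refine ext_inner_left ℂ fun η => ?_
  rw [inner_tau, h]

theorem tau_hat {X Y : C} (a : X ⟶ Y) : ρ.tau (hat a) = ρ.sigma a :=
  ρ.tau_eq_of_inner fun _ _ => rfl

/-- `τ` as a linear map. -/
noncomputable def tauₗ (X Y : C) : Bidual X Y →ₗ[ℂ] (ρ.HUniv →L[ℂ] ρ.HUniv) where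
  toFun := ρ.tau
  map_add' F G := ρ.tau_eq_of_inner fun η ξ => by
    rw [add_apply, add_apply, inner_add_right,
      inner_tau, inner_tau]
  map_smul' c F := ρ.tau_eq_of_inner fun η ξ => by
    rw [smul_apply, RingHom.id_apply, smul_apply,
      inner_smul_right, inner_tau, smul_eq_mul]

/-- Coefficient functionals are stable under the two Arens operations: for `f` the coefficient of
`(η, ξ)`, `bf` is that of `(σ(b)* η, ξ)`, and therefore `fF` is that of `(η, τ(F) ξ)`. -/
theorem tau_arensComp {X Y Z : C} (G : Bidual Y Z) (F : Bidual X Y) :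
    ρ.tau (arensComp G F) = ρ.tau G ∘L ρ.tau F := by
  refine ρ.tau_eq_of_inner fun η ξ => ?_
  have h1 : ∀ b : Y ⟶ Z, arensLeft (ρ.coeffFunctional X Z η ξ) b =
      ρ.coeffFunctional X Y (ContinuousLinearMap.adjoint (ρ.sigma b) η) ξ := fun b => by
    ext a
    rw [arensLeft_apply, coeffFunctional_apply, coeffFunctional_apply, sigma_comp,
      ContinuousLinearMap.adjoint_inner_left]
    rfl
  have h2 : arensMiddle F (ρ.coeffFunctional X Z η ξ) =
      ρ.coeffFunctional Y Z η (ρ.tau F ξ) := by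
    ext b
    rw [arensMiddle_apply, h1, ← inner_tau, ContinuousLinearMap.adjoint_inner_left,
      coeffFunctional_apply]
  rw [arensComp_apply, h2, ← inner_tau]
  rfl

theorem tau_bidualAdj {X Y : C} (F : Bidual X Y) :
    ρ.tau (bidualAdj F) = ContinuousLinearMap.adjoint (ρ.tau F) := by
  refine ρ.tau_eq_of_inner fun η ξ => ?_
  have h1 : dualAdj (ρ.coeffFunctional Y X η ξ) = ρ.coeffFunctional X Y ξ η := by
    ext a
    rw [dualAdj_apply, coeffFunctional_apply, coeffFunctional_apply, sigma_adj,
      ContinuousLinearMap.adjoint_inner_right, Complex.star_def, inner_conj_symm]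
  rw [bidualAdj_apply, h1, ← inner_tau, ContinuousLinearMap.adjoint_inner_right,
    Complex.star_def, inner_conj_symm]

variable {ρ} in
-- The upper bound comes from testing against `η = τ(F) ξ`. The lower bound uses that each `f` is a
-- coefficient with `‖η‖ * ‖ξ‖ ≤ ‖f‖`.
theorem Faithful.norm_tau (hρ : ρ.Faithful) {X Y : C} (F : Bidual X Y) : ‖ρ.tau F‖ = ‖F‖ := by
  refine le_antisymm (ContinuousLinearMap.opNorm_le_bound _ (norm_nonneg F) fun ξ => ?_)
    (F.opNorm_le_bound (norm_nonneg _) fun f => ?_)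
  · rcases (norm_nonneg (ρ.tau F ξ)).eq_or_lt with h0 | h0
    · rw [← h0]
      positivity
    refine le_of_mul_le_mul_left ?_ h0
    calc ‖ρ.tau F ξ‖ * ‖ρ.tau F ξ‖ = ‖⟪ρ.tau F ξ, ρ.tau F ξ⟫_ℂ‖ := by
          rw [← sq, inner_self_eq_norm_sq_to_K, norm_pow, RCLike.norm_ofReal, abs_norm]
      _ = ‖F (ρ.coeffFunctional X Y (ρ.tau F ξ) ξ)‖ := by rw [inner_tau]
      _ ≤ ‖F‖ * (‖ρ.tau F ξ‖ * ‖ξ‖) :=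
          F.le_of_opNorm_le_of_le le_rfl (ρ.norm_coeffFunctional_le _ _)
      _ = ‖ρ.tau F ξ‖ * (‖F‖ * ‖ξ‖) := mul_left_comm _ _ _
  · obtain ⟨η, ξ, hn, rfl⟩ := hρ.exists_coeff f
    rw [← inner_tau]
    calc ‖⟪η, ρ.tau F ξ⟫_ℂ‖ ≤ ‖η‖ * (‖ρ.tau F‖ * ‖ξ‖) :=
          (norm_inner_le_norm _ _).trans (by gcongr; exact (ρ.tau F).le_opNorm ξ)
      _ = ‖ρ.tau F‖ * (‖η‖ * ‖ξ‖) := mul_left_comm _ _ _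
      _ ≤ _ := by gcongr

variable {ρ} in
theorem Faithful.tau_injective (hρ : ρ.Faithful) (X Y : C) :
    Function.Injective (ρ.tau : Bidual X Y → _) :=
  (AddMonoidHomClass.isometry_of_norm (ρ.tauₗ X Y) fun F => hρ.norm_tau F).injective

variable {ρ} in
theorem Faithful.stComp_eq_arensComp (hρ : ρ.Faithful) {X Y Z : C} (G : Bidual Y Z)
    (F : Bidual X Y) : ρ.stComp G F = arensComp G F := by
  rw [stComp, ← tau_arensComp]
  exact Function.leftInverse_invFun (hρ.tau_injective X Z) _

theorem continuous_tau (X Y : C) :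
    Continuous (fun F : WeakDual ℂ (StrongDual ℂ (X ⟶ Y)) =>
      ContinuousLinearMapWOT.ofCLM (ρ.tau (WeakDual.toStrongDual F))) := by
  refine ContinuousLinearMapWOT.continuous_iff.mpr fun ξ η => ?_
  have h : ∀ F : WeakDual ℂ (StrongDual ℂ (X ⟶ Y)),
      ⟪η, ContinuousLinearMapWOT.ofCLM (ρ.tau (WeakDual.toStrongDual F)) ξ⟫_ℂ =
        F (ρ.coeffFunctional X Y η ξ) := fun F => ρ.inner_tau _ _ _
  simp only [h]
  exact WeakDual.eval_continuous _

variable {ρ} in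
-- Weak* convergence is tested on all functionals and weak operator convergence on all coefficients,
-- and each functional is a coefficient.
theorem Faithful.isEmbedding_tau (hρ : ρ.Faithful) (X Y : C) :
    Topology.IsEmbedding (fun F : WeakDual ℂ (StrongDual ℂ (X ⟶ Y)) =>
      ContinuousLinearMapWOT.ofCLM (ρ.tau (WeakDual.toStrongDual F))) := by
  refine ⟨Topology.isInducing_iff_nhds.mpr fun F => le_antisymm
    ((ρ.continuous_tau X Y).tendsto F).le_comap ?_, fun F G h => ?_⟩
  · refine Filter.tendsto_id'.mp
      (tendsto_iff_forall_eval_tendsto_topDualPairing.mpr fun f => ?_)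
    obtain ⟨η, ξ, -, rfl⟩ := hρ.exists_coeff f
    have h := ContinuousLinearMapWOT.tendsto_iff_forall_inner_apply_tendsto.mp
      (Filter.tendsto_comap (x := nhds (ContinuousLinearMapWOT.ofCLM
          (ρ.tau (WeakDual.toStrongDual F)))) (f := fun F : WeakDual ℂ (StrongDual ℂ (X ⟶ Y)) =>
        ContinuousLinearMapWOT.ofCLM (ρ.tau (WeakDual.toStrongDual F)))) ξ η
    simp only [ContinuousLinearMapWOT.ofCLM_apply, inner_tau] at h
    exact h
  · exact WeakDual.toStrongDual.injective
      (hρ.tau_injective X Y (ContinuousLinearMapWOT.ofCLM_injective h))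

variable {ρ} in
-- One inclusion is weak* density together with continuity. For the other, a filter on `(X, Y)`
-- along which `σ` tends to `T` converges on every functional, each being a coefficient. The limit
-- is bounded by `‖T‖ * ‖f‖` whether or not the filter is bounded, thanks to the norm control on the
-- vectors.
theorem Faithful.range_tau (hρ : ρ.Faithful) (X Y : C) :
    Set.range (fun F : Bidual X Y => ContinuousLinearMapWOT.ofCLM (ρ.tau F)) =
      ρ.wotClosure X Y := by
  refine Set.Subset.antisymm ?_ fun T hT => ?_
  · rintro _ ⟨F, rfl⟩
    have h := (ρ.continuous_tau X Y).range_subset_closure_image_dense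
      (denseRange_toWeakDual_inclusionInDoubleDual (E := X ⟶ Y))
    refine closure_mono ?_ (h ⟨WeakDual.toStrongDual.symm F, rfl⟩)
    rintro _ ⟨_, ⟨a, rfl⟩, rfl⟩
    exact ⟨a, congrArg ContinuousLinearMapWOT.ofCLM (ρ.tau_hat a).symm⟩
  · let l : Filter (X ⟶ Y) :=
      Filter.comap (fun a => ContinuousLinearMapWOT.ofCLM (ρ.sigma a)) (nhds T)
    have hl : l.NeBot := Filter.comap_neBot_iff_frequently.mpr (mem_closure_iff_frequently.mp hT)
    choose η ξ hn hc using fun f : StrongDual ℂ (X ⟶ Y) => hρ.exists_coeff f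
    have hT' : Filter.Tendsto (fun a => ContinuousLinearMapWOT.ofCLM (ρ.sigma a)) l (nhds T) :=
      Filter.tendsto_comap
    have hlim : ∀ η ξ, Filter.Tendsto (fun a => ρ.coeffFunctional X Y η ξ a) l
        (nhds ⟪η, T ξ⟫_ℂ) := fun η ξ => by
      simpa only [coeffFunctional_apply, ContinuousLinearMapWOT.ofCLM_apply] using
        ContinuousLinearMapWOT.tendsto_iff_forall_inner_apply_tendsto.mp hT' ξ η
    have hf : ∀ f : StrongDual ℂ (X ⟶ Y), Filter.Tendsto (fun a => f a) l
        (nhds ⟪η f, T (ξ f)⟫_ℂ) := fun f => by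
      have := hlim (η f) (ξ f)
      rwa [hc] at this
    obtain ⟨F, hF⟩ := exists_bidual_of_tendsto hf (M := ‖T.toCLM‖) fun f =>
      calc ‖⟪η f, T.toCLM (ξ f)⟫_ℂ‖ ≤ ‖η f‖ * (‖T.toCLM‖ * ‖ξ f‖) :=
            (norm_inner_le_norm _ _).trans (by gcongr; exact T.toCLM.le_opNorm _)
        _ = ‖T.toCLM‖ * (‖η f‖ * ‖ξ f‖) := mul_left_comm _ _ _
        _ ≤ ‖T.toCLM‖ * ‖f‖ := by gcongr; exact hn f
    refine ⟨F, ?_⟩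
    -- The vectors chosen for a coefficient functional may differ from the given `η` and `ξ`, but
    -- the limits agree.
    have h : ρ.tau F = T.toCLM := ρ.tau_eq_of_inner fun η ξ =>
      (hF _).trans <| tendsto_nhds_unique (hf (ρ.coeffFunctional X Y η ξ)) (hlim η ξ)
    change ContinuousLinearMapWOT.ofCLM (ρ.tau F) = T
    rw [h, ContinuousLinearMapWOT.ofCLM_toCLM]

end CStarFunctor
end Representation

/-! ### The C*-category axioms for the biduals. -/

/-- The square root vanishes at zero, so the non-unital functional calculus keeps it in a closed
subalgebra without the unit. -/
theorem NonUnitalStarSubalgebra.exists_star_mul_self_eq {A : Type*} [CStarAlgebra A]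
    [PartialOrder A] [StarOrderedRing A] (S : NonUnitalStarSubalgebra ℂ A)
    (hS : IsClosed (S : Set A)) {a : A} (ha : 0 ≤ a) (hmem : a ∈ S) :
    ∃ r ∈ S, star r * r = a := by
  have hsq : CFC.sqrt a * CFC.sqrt a = a := CFC.sqrt_mul_sqrt_self a ha
  refine ⟨CFC.sqrt a, ?_, ?_⟩
  · rw [CFC.sqrt_eq_real_sqrt a ha]
    exact cfcₙ_mem (𝕜' := ℂ) _ hmem
  · rwa [(IsSelfAdjoint.of_nonneg (CFC.sqrt_nonneg a)).star_eq]

section BidualCategory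

variable {C : Type u} [CStarCategoryStruct.{u, v} C] [IsCStarCategory C]

open IsCStarCategory

theorem arensComp_hat_id {X Y : C} (F : Bidual X Y) : arensComp F (hat (𝟙 X)) = F := by
  ext f
  rw [arensComp_apply]
  congr 1
  ext b
  change f (𝟙 X ≫ b) = f b
  rw [id_comp]

theorem hat_id_arensComp {X Y : C} (F : Bidual X Y) : arensComp (hat (𝟙 Y)) F = F := by
  ext f
  change F (arensLeft f (𝟙 Y)) = F f
  congr 1
  ext a
  rw [arensLeft_apply, comp_id]

namespace CStarFunctor

variable {ρ : CStarFunctor C HilbSp.{w}}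

/-- The operators `τ(F)`, `F ∈ (X, X)''`, as a *-algebra. -/
noncomputable def tauSubalgebra (ρ : CStarFunctor C HilbSp.{w}) (X : C) :
    NonUnitalStarSubalgebra ℂ (ρ.HUniv →L[ℂ] ρ.HUniv) where
  toNonUnitalSubalgebra :=
    { LinearMap.range (ρ.tauₗ X X) with
      mul_mem' := by
        rintro _ _ ⟨G, rfl⟩ ⟨F, rfl⟩
        exact ⟨arensComp G F, ρ.tau_arensComp G F⟩ }
  star_mem' := by
    rintro _ ⟨F, rfl⟩
    exact ⟨bidualAdj F, ρ.tau_bidualAdj F⟩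

theorem Faithful.isClosed_tauSubalgebra (hρ : ρ.Faithful) (X : C) :
    IsClosed (ρ.tauSubalgebra X : Set (ρ.HUniv →L[ℂ] ρ.HUniv)) :=
  (AddMonoidHomClass.isometry_of_norm (ρ.tauₗ X X)
    fun F => hρ.norm_tau F).isClosedEmbedding.isClosed_range

/-- `τ(H)* τ(H)` is a positive element of the norm closed *-algebra `τ((X, X)'')`, so its square
root is some `τ(G)`. -/
theorem Faithful.exists_arensComp_eq (hρ : ρ.Faithful) {X Y : C} (H : Bidual X Y) :
    ∃ G : Bidual X X, arensComp (bidualAdj H) H = arensComp (bidualAdj G) G := by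
  let a : ρ.HUniv →L[ℂ] ρ.HUniv := star (ρ.tau H) * ρ.tau H
  have ha : 0 ≤ a := star_mul_self_nonneg _
  have hmem : a ∈ ρ.tauSubalgebra X := ⟨arensComp (bidualAdj H) H, by
    change ρ.tau _ = a
    rw [tau_arensComp, tau_bidualAdj]
    rfl⟩
  obtain ⟨_, ⟨G, rfl⟩, hG⟩ :=
    (ρ.tauSubalgebra X).exists_star_mul_self_eq (hρ.isClosed_tauSubalgebra X) ha hmem
  refine ⟨G, hρ.tau_injective X X ?_⟩
  rw [tau_arensComp, tau_arensComp, tau_bidualAdj, tau_bidualAdj]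
  exact hG.symm

theorem tau_add (ρ : CStarFunctor C HilbSp.{w}) {X Y : C} (F G : Bidual X Y) :
    ρ.tau (F + G) = ρ.tau F + ρ.tau G := map_add (ρ.tauₗ X Y) F G

theorem tau_smul (ρ : CStarFunctor C HilbSp.{w}) {X Y : C} (c : ℂ) (F : Bidual X Y) :
    ρ.tau (c • F) = c • ρ.tau F := map_smul (ρ.tauₗ X Y) c F

/-- This and the following identities hold for operators on a Hilbert space and are pulled back
along the injective map `τ`. -/
theorem Faithful.arensComp_assoc (hρ : ρ.Faithful) {X Y Z W : C} (a : Bidual X Y)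
    (b : Bidual Y Z) (c : Bidual Z W) :
    arensComp c (arensComp b a) = arensComp (arensComp c b) a := hρ.tau_injective _ _ (by
  rw [tau_arensComp, tau_arensComp, tau_arensComp, tau_arensComp]
  exact (ContinuousLinearMap.comp_assoc _ _ _).symm)

theorem Faithful.arensComp_add (hρ : ρ.Faithful) {X Y Z : C} (a a' : Bidual X Y)
    (b : Bidual Y Z) :
    arensComp b (a + a') = arensComp b a + arensComp b a' := hρ.tau_injective _ _ (by
  simp only [tau_arensComp, tau_add, ContinuousLinearMap.comp_add])

theorem Faithful.add_arensComp (hρ : ρ.Faithful) {X Y Z : C} (a : Bidual X Y)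
    (b b' : Bidual Y Z) :
    arensComp (b + b') a = arensComp b a + arensComp b' a := hρ.tau_injective _ _ (by
  simp only [tau_arensComp, tau_add, ContinuousLinearMap.add_comp])

theorem Faithful.arensComp_smul (hρ : ρ.Faithful) {X Y Z : C} (c : ℂ) (a : Bidual X Y)
    (b : Bidual Y Z) :
    arensComp b (c • a) = c • arensComp b a := hρ.tau_injective _ _ (by
  simp only [tau_arensComp, tau_smul, ContinuousLinearMap.comp_smul])

theorem Faithful.smul_arensComp (hρ : ρ.Faithful) {X Y Z : C} (c : ℂ) (a : Bidual X Y)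
    (b : Bidual Y Z) :
    arensComp (c • b) a = c • arensComp b a := hρ.tau_injective _ _ (by
  simp only [tau_arensComp, tau_smul, ContinuousLinearMap.smul_comp])

theorem Faithful.bidualAdj_add (hρ : ρ.Faithful) {X Y : C} (a b : Bidual X Y) :
    bidualAdj (a + b) = bidualAdj a + bidualAdj b := hρ.tau_injective _ _ (by
  simp only [tau_bidualAdj, tau_add, map_add])

theorem Faithful.bidualAdj_smul (hρ : ρ.Faithful) {X Y : C} (c : ℂ) (a : Bidual X Y) :
    bidualAdj (c • a) = star c • bidualAdj a := hρ.tau_injective _ _ (by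
  simp only [tau_bidualAdj, tau_smul, map_smulₛₗ]
  rfl)

theorem Faithful.bidualAdj_bidualAdj (hρ : ρ.Faithful) {X Y : C} (a : Bidual X Y) :
    bidualAdj (bidualAdj a) = a := hρ.tau_injective _ _ (by
  simp only [tau_bidualAdj, ContinuousLinearMap.adjoint_adjoint])

theorem Faithful.bidualAdj_arensComp (hρ : ρ.Faithful) {X Y Z : C} (a : Bidual X Y)
    (b : Bidual Y Z) :
    bidualAdj (arensComp b a) = arensComp (bidualAdj a) (bidualAdj b) := hρ.tau_injective _ _ (by
  simp only [tau_bidualAdj, tau_arensComp, ContinuousLinearMap.adjoint_comp])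

theorem Faithful.norm_arensComp_le (hρ : ρ.Faithful) {X Y Z : C} (a : Bidual X Y)
    (b : Bidual Y Z) :
    ‖arensComp b a‖ ≤ ‖a‖ * ‖b‖ := by
  rw [← hρ.norm_tau, ← hρ.norm_tau a, ← hρ.norm_tau b, tau_arensComp, mul_comm]
  exact ContinuousLinearMap.opNorm_comp_le _ _

theorem Faithful.norm_sq_eq_norm_arensComp (hρ : ρ.Faithful) {X Y : C} (a : Bidual X Y) :
    ‖a‖ ^ 2 = ‖arensComp (bidualAdj a) a‖ := by
  rw [← hρ.norm_tau a, ← hρ.norm_tau (arensComp _ _), tau_arensComp, tau_bidualAdj, sq]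
  exact (ContinuousLinearMap.norm_adjoint_comp_self _).symm

theorem Faithful.isCStarCategory_arensBidual (hρ : ρ.Faithful) :
    @IsCStarCategory C (arensBidual C) :=
  @IsCStarCategory.mk C (arensBidual C) arensComp_hat_id hat_id_arensComp hρ.arensComp_assoc
    (fun X Y => inferInstanceAs (CompleteSpace (Bidual X Y)))
    hρ.arensComp_add hρ.add_arensComp hρ.arensComp_smul hρ.smul_arensComp hρ.bidualAdj_add
    hρ.bidualAdj_smul hρ.bidualAdj_bidualAdj hρ.bidualAdj_arensComp hρ.norm_arensComp_le
    hρ.norm_sq_eq_norm_arensComp hρ.exists_arensComp_eq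

theorem Faithful.arensBidual_eq (hρ : ρ.Faithful) : arensBidual C = ρ.shermanTakedaBidual := by
  -- The two structures differ only in their composition.
  have h : @arensComp C _ _ = fun {X Y Z} => ρ.stComp := by
    funext X Y Z G F
    exact (hρ.stComp_eq_arensComp G F).symm
  unfold arensBidual shermanTakedaBidual
  rw [h]

end CStarFunctor
end BidualCategory

/-! ### Existence of a faithful functor: a GNS construction for C*-categories. -/

section DiagonalMap

variable {ι : Type*} {E G : ι → Type*} [∀ i, NormedAddCommGroup (E i)]
  [∀ i, InnerProductSpace ℂ (E i)] [∀ i, NormedAddCommGroup (G i)]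
  [∀ i, InnerProductSpace ℂ (G i)]

/-- The diagonal operator between Hilbert sums given by a uniformly bounded family. -/
noncomputable def diagMap (T : ∀ i, E i →L[ℂ] G i) (M : ℝ) (hM : 0 ≤ M) (hT : ∀ i, ‖T i‖ ≤ M) :
    lp E 2 →L[ℂ] lp G 2 :=
  have hle : ∀ (x : lp E 2) (i : ι), ‖T i (x i)‖ ≤ ‖(M : ℂ) • x i‖ := fun x i => by
    rw [norm_smul, Complex.norm_real, Real.norm_of_nonneg hM]
    exact (T i).le_of_opNorm_le (hT i) _
  have hmem : ∀ x : lp E 2, Memℓp (fun i => T i (x i)) 2 := fun x =>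
    (((M : ℂ) • x : lp E 2).2).mono' (hle x)
  LinearMap.mkContinuous
    { toFun := fun x => (⟨fun i => T i (x i), hmem x⟩ : lp G 2)
      map_add' := fun x y => by ext i; exact map_add (T i) _ _
      map_smul' := fun c x => by ext i; exact map_smul (T i) _ _ } M
    (fun x => by
      have : ‖(⟨fun i => T i (x i), hmem x⟩ : lp G 2)‖ ≤ ‖(M : ℂ) • x‖ :=
        lp.norm_mono two_ne_zero (hle x)
      rwa [norm_smul, Complex.norm_real, Real.norm_of_nonneg hM] at this)

theorem diagMap_apply (T : ∀ i, E i →L[ℂ] G i) (M : ℝ) (hM : 0 ≤ M) (hT : ∀ i, ‖T i‖ ≤ M)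
    (x : lp E 2) (i : ι) : diagMap T M hM hT x i = T i (x i) := rfl

end DiagonalMap

section GNSFunctor

open CStarCategoryStruct (adj)

open IsCStarCategory

variable {C : Type u} [CStarCategoryStruct.{u, v} C] [IsCStarCategory C]

/-- The endomorphism space `(X, X)` as a unital C*-algebra. -/
@[reducible]
noncomputable def endUnitalCStarAlgebra (X : C) : CStarAlgebra (X ⟶ X) :=
  letI := endCStarAlgebra X
  letI : NormedRing (X ⟶ X) :=
    { endNormedRing X with
      one := 𝟙 X
      one_mul := fun a => comp_id a
      mul_one := fun a => id_comp a }
  letI : Algebra ℂ (X ⟶ X) := Algebra.ofModule (fun c a b => comp_smul c b a)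
    (fun c a b => smul_comp c b a)
  { endCStarAlgebra X with
    one := 𝟙 X
    one_mul := fun a => comp_id a
    mul_one := fun a => id_comp a
    algebraMap := algebraMap ℂ (X ⟶ X)
    commutes' := Algebra.commutes
    smul_def' := Algebra.smul_def
    norm_smul_le := norm_smul_le }

/-- In a C*-category, `b* b ≤ ‖b‖² 1`. -/
theorem exists_norm_sq_smul_id_sub {X Y : C} (b : X ⟶ Y) :
    ∃ c : X ⟶ X, ((‖b‖ ^ 2 : ℝ) : ℂ) • 𝟙 X = b ≫ adj b + c ≫ adj c := by
  let _ := endUnitalCStarAlgebra X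
  let _ := CStarAlgebra.spectralOrder (X ⟶ X)
  let _ := CStarAlgebra.spectralOrderedRing (X ⟶ X)
  -- Only the positivity axiom of a C*-category makes `b* b` positive in the C*-algebra `(X, X)`.
  obtain ⟨g, hg⟩ := IsCStarCategory.pos b
  have h1 : star g * g ≤ algebraMap ℝ (X ⟶ X) ‖star g * g‖ :=
    IsSelfAdjoint.le_algebraMap_norm_self (.star_mul_self g)
  obtain ⟨c, hc⟩ := CStarAlgebra.nonneg_iff_eq_star_mul_self.mp (sub_nonneg.mpr h1)
  refine ⟨c, ?_⟩
  have h2 : ‖star g * g‖ = ‖b‖ ^ 2 := by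
    rw [norm_sq b, hg]
    rfl
  rw [h2, Algebra.algebraMap_eq_smul_one, sub_eq_iff_eq_add'] at hc
  rw [hg, Complex.coe_smul]
  exact hc

variable (C) in
/-- A positive functional on the endomorphisms of an object. -/
structure EndPositive where
  base : C
  toFun : (base ⟶ base) →ₗ[ℂ] ℂ
  map_adj : ∀ g, toFun (adj g) = star (toFun g)
  nonneg : ∀ {Y : C} (g : base ⟶ Y), 0 ≤ toFun (g ≫ adj g)

namespace EndPositive

/-- Write `a* a = g* g` with `g` an endomorphism. Dominating the functional `c g ↦ c ‖g‖` on the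
line through `g` gives `φ` with `φ(g* g) ≥ ‖g‖² > 0`. -/
theorem exists_of_ne_zero {X Y : C} {a : X ⟶ Y} (ha : a ≠ 0) :
    ∃ φ : (X ⟶ X) →ₗ[ℂ] ℂ, (∀ g, φ (adj g) = star (φ g)) ∧
      (∀ {Z : C} (g : X ⟶ Z), 0 ≤ φ (g ≫ adj g)) ∧ φ (a ≫ adj a) ≠ 0 := by
  let _ := endUnitalCStarAlgebra X
  let _ := CStarAlgebra.spectralOrder (X ⟶ X)
  let _ := CStarAlgebra.spectralOrderedRing (X ⟶ X)
  obtain ⟨g, hg⟩ := IsCStarCategory.pos a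
  have hpos : 0 < ‖g‖ := by
    have h1 : ‖a‖ ^ 2 = ‖g‖ ^ 2 := by rw [norm_sq, norm_sq, hg]
    have h2 : ‖a‖ = ‖g‖ := (pow_left_inj₀ (norm_nonneg _) (norm_nonneg _) two_ne_zero).mp h1
    rw [← h2]
    exact norm_pos_iff.mpr ha
  obtain ⟨φ, -, hφ⟩ := exists_positive_dominating (LinearMap.toSpanSingleton ℂ (X ⟶ X) g)
    (LinearMap.toSpanSingleton ℂ ℂ (‖g‖ : ℂ)) (fun c => by
      rw [LinearMap.toSpanSingleton_apply, LinearMap.toSpanSingleton_apply, norm_smul, norm_smul,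
        Complex.norm_real, norm_norm])
  refine ⟨(φ : (X ⟶ X) →ₗ[ℂ] ℂ), fun g => map_star φ g, fun g => ?_, ?_⟩
  · obtain ⟨g', hg'⟩ := IsCStarCategory.pos g
    rw [hg']
    exact φ.map_nonneg (star_mul_self_nonneg g')
  have h := hφ 1
  rw [LinearMap.toSpanSingleton_apply, LinearMap.toSpanSingleton_apply, one_smul, one_smul,
    Complex.norm_real, norm_norm] at h
  rw [hg]
  intro h0
  have h0' : φ (star g * g) = 0 := h0
  rw [h0', Complex.zero_re] at h
  exact absurd h (not_le.mpr (by positivity))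

variable (d : EndPositive C)

/-- The space `(X, Y)` with the inner product `⟪a, b⟫ = φ(a* b)`. -/
def PreSpace (d : EndPositive C) (Y : C) : Type v := d.base ⟶ Y

instance (Y : C) : AddCommGroup (d.PreSpace Y) := inferInstanceAs (AddCommGroup (d.base ⟶ Y))
instance (Y : C) : Module ℂ (d.PreSpace Y) := inferInstanceAs (Module ℂ (d.base ⟶ Y))

/-- The identity map of `(X, Y)`, into the pre-Hilbert space. -/
def toPre (Y : C) : (d.base ⟶ Y) ≃ₗ[ℂ] d.PreSpace Y := LinearEquiv.refl ℂ _

/-- The inner product `⟪a, b⟫ = φ(a* b)`. -/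
noncomputable abbrev preCore (Y : C) : PreInnerProductSpace.Core ℂ (d.PreSpace Y) where
  inner a b := d.toFun ((d.toPre Y).symm b ≫ adj ((d.toPre Y).symm a))
  conj_inner_symm a b := by
    rw [← Complex.star_def, ← d.map_adj, adj_comp, adj_adj]
  re_inner_nonneg a := (RCLike.nonneg_iff.mp (d.nonneg _)).1
  add_left a b c := by
    rw [map_add, adj_add, comp_add, map_add]
  smul_left a b c := by
    rw [map_smul, adj_smul, comp_smul, map_smul]
    rfl

noncomputable instance (Y : C) : SeminormedAddCommGroup (d.PreSpace Y) :=
  InnerProductSpace.Core.toSeminormedAddCommGroup (c := d.preCore Y)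

noncomputable instance (Y : C) : InnerProductSpace ℂ (d.PreSpace Y) :=
  InnerProductSpace.ofCore (d.preCore Y)

theorem inner_toPre {Y : C} (a b : d.base ⟶ Y) :
    ⟪d.toPre Y a, d.toPre Y b⟫_ℂ = d.toFun (b ≫ adj a) := rfl

theorem norm_toPre_sq {Y : C} (a : d.base ⟶ Y) :
    ‖d.toPre Y a‖ ^ 2 = (d.toFun (a ≫ adj a)).re := by
  rw [← inner_toPre, ← inner_self_eq_norm_sq (𝕜 := ℂ)]
  rfl

/-- Since `‖b‖² 1 - b* b = c* c`, the difference of the squared norms is `φ((c a)* (c a)) ≥ 0`. This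
boundedness lets composition with `b` extend to the completion. -/
theorem norm_toPre_comp_le {Y Z : C} (b : Y ⟶ Z) (a : d.base ⟶ Y) :
    ‖d.toPre Z (a ≫ b)‖ ≤ ‖b‖ * ‖d.toPre Y a‖ := by
  refine le_of_sq_le_sq ?_ (by positivity)
  obtain ⟨c, hc⟩ := exists_norm_sq_smul_id_sub b
  have h1 : ((‖b‖ ^ 2 : ℝ) : ℂ) • (a ≫ adj a) =
      (a ≫ b) ≫ adj (a ≫ b) + (a ≫ c) ≫ adj (a ≫ c) := by
    have h2 : ∀ {W : C} (e : Y ⟶ W), (a ≫ e) ≫ adj (a ≫ e) = (a ≫ (e ≫ adj e)) ≫ adj a :=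
      fun e => by simp only [adj_comp, IsCStarCategory.assoc]
    rw [h2, h2, ← add_comp, ← comp_add, ← hc, comp_smul, comp_id, smul_comp]
  rw [mul_pow, norm_toPre_sq, norm_toPre_sq, ← Complex.re_ofReal_mul, ← smul_eq_mul, ← map_smul,
    h1, map_add, Complex.add_re]
  exact le_add_of_nonneg_right (Complex.le_def.mp (d.nonneg (a ≫ c))).1

/-- The Hilbert space completion of `(X, Y)`. -/
abbrev Space (d : EndPositive C) (Y : C) : Type v := UniformSpace.Completion (d.PreSpace Y)

/-- The vector defined by a morphism `X ⟶ Y`. -/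
noncomputable def vec {Y : C} (a : d.base ⟶ Y) : d.Space Y := (d.toPre Y a : d.PreSpace Y)

theorem denseRange_vec (Y : C) : DenseRange (d.vec : (d.base ⟶ Y) → d.Space Y) :=
  UniformSpace.Completion.denseRange_coe.comp (d.toPre Y).surjective.denseRange
    (UniformSpace.Completion.continuous_coe _)

theorem inner_vec {Y : C} (a b : d.base ⟶ Y) : ⟪d.vec a, d.vec b⟫_ℂ = d.toFun (b ≫ adj a) := by
  rw [vec, vec, UniformSpace.Completion.inner_coe, inner_toPre]

theorem vec_add {Y : C} (a b : d.base ⟶ Y) : d.vec (a + b) = d.vec a + d.vec b := by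
  rw [vec, map_add, UniformSpace.Completion.coe_add]
  rfl

theorem vec_smul {Y : C} (c : ℂ) (a : d.base ⟶ Y) : d.vec (c • a) = c • d.vec a := by
  rw [vec, map_smul, UniformSpace.Completion.coe_smul]
  rfl

/-- Composition with `b` as an operator between the pre-Hilbert spaces. -/
noncomputable def preMap {Y Z : C} (b : Y ⟶ Z) : d.PreSpace Y →L[ℂ] d.PreSpace Z :=
  LinearMap.mkContinuous
    { toFun := fun x => d.toPre Z ((d.toPre Y).symm x ≫ b)
      map_add' := fun x y => by rw [map_add, add_comp, map_add]
      map_smul' := fun c x => by rw [map_smul, smul_comp, map_smul, RingHom.id_apply] } ‖b‖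
    (fun x => d.norm_toPre_comp_le b ((d.toPre Y).symm x))

/-- Composition with `b` as an operator between the Hilbert spaces. -/
noncomputable def opMap {Y Z : C} (b : Y ⟶ Z) : d.Space Y →L[ℂ] d.Space Z :=
  (d.preMap b).completion

theorem opMap_vec {Y Z : C} (b : Y ⟶ Z) (a : d.base ⟶ Y) :
    d.opMap b (d.vec a) = d.vec (a ≫ b) := by
  rw [vec, opMap, ContinuousLinearMap.completion_apply_coe]
  rfl

theorem ext_vec {Y : C} {H : Type*} [NormedAddCommGroup H] [NormedSpace ℂ H]
    {S T : d.Space Y →L[ℂ] H} (h : ∀ a, S (d.vec a) = T (d.vec a)) : S = T :=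
  DFunLike.coe_injective ((d.denseRange_vec Y).equalizer S.continuous T.continuous (funext h))

theorem norm_opMap_le {Y Z : C} (b : Y ⟶ Z) : ‖d.opMap b‖ ≤ ‖b‖ := by
  refine ContinuousLinearMap.opNorm_le_bound _ (norm_nonneg b) fun x => ?_
  refine (d.denseRange_vec Y).induction_on x (isClosed_le (by fun_prop) (by fun_prop)) fun a => ?_
  rw [opMap_vec, vec, vec, UniformSpace.Completion.norm_coe, UniformSpace.Completion.norm_coe]
  exact d.norm_toPre_comp_le b a

theorem opMap_add {Y Z : C} (b c : Y ⟶ Z) : d.opMap (b + c) = d.opMap b + d.opMap c :=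
  d.ext_vec fun a => by
    rw [add_apply, opMap_vec, opMap_vec, opMap_vec, comp_add, vec_add]

theorem opMap_smul {Y Z : C} (c : ℂ) (b : Y ⟶ Z) : d.opMap (c • b) = c • d.opMap b :=
  d.ext_vec fun a => by
    rw [smul_apply, opMap_vec, opMap_vec, comp_smul, vec_smul]

theorem opMap_id (Y : C) : d.opMap (𝟙 Y) = ContinuousLinearMap.id ℂ _ :=
  d.ext_vec fun a => by
    rw [opMap_vec, comp_id]
    rfl

theorem opMap_comp {Y Z W : C} (b : Y ⟶ Z) (c : Z ⟶ W) :
    d.opMap (b ≫ c) = d.opMap c ∘L d.opMap b :=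
  d.ext_vec fun a => by
    rw [ContinuousLinearMap.comp_apply, opMap_vec, opMap_vec, opMap_vec, IsCStarCategory.assoc]

theorem opMap_adj {Y Z : C} (b : Y ⟶ Z) :
    d.opMap (adj b) = ContinuousLinearMap.adjoint (d.opMap b) :=
  d.ext_vec fun a => (d.denseRange_vec Y).eq_of_inner_right ℂ fun c => by
    rw [ContinuousLinearMap.adjoint_inner_right, opMap_vec, opMap_vec, inner_vec, inner_vec,
      adj_comp, IsCStarCategory.assoc]

end EndPositive

variable (C) in
/-- The Hilbert sum of the GNS functors of all positive functionals on endomorphisms. -/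
noncomputable def gnsFunctor : CStarFunctor C HilbSp.{max u v} where
  obj Y := ⟨lp (fun d : EndPositive C => d.Space Y) 2⟩
  map {Y Z} :=
    { toFun := fun b => diagMap (fun d : EndPositive C => d.opMap b) ‖b‖ (norm_nonneg b)
        fun d => d.norm_opMap_le b
      map_add' := fun b c => by
        refine ContinuousLinearMap.ext fun x => ?_
        ext d
        exact congrArg (fun T => T (x d)) (d.opMap_add b c)
      map_smul' := fun c b => by
        refine ContinuousLinearMap.ext fun x => ?_
        ext d
        exact congrArg (fun T => T (x d)) (d.opMap_smul c b) }
  map_id Y := by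
    refine ContinuousLinearMap.ext fun x => ?_
    ext d
    exact congrArg (fun T => T (x d)) (d.opMap_id Y)
  map_comp b c := by
    refine ContinuousLinearMap.ext fun x => ?_
    ext d
    exact congrArg (fun T => T (x d)) (d.opMap_comp b c)
  map_adj b := by
    refine (ContinuousLinearMap.eq_adjoint_iff _ _).mpr fun x y => ?_
    rw [lp.inner_eq_tsum, lp.inner_eq_tsum]
    refine tsum_congr fun d => ?_
    change ⟪d.opMap (adj b) (x d), y d⟫_ℂ = ⟪x d, d.opMap b (y d)⟫_ℂ
    rw [d.opMap_adj, ContinuousLinearMap.adjoint_inner_left]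

variable (C) in
-- For `a ≠ 0`, take the summand of a functional `φ` on `(X, X)` with `φ(a* a) ≠ 0`. There the
-- operator of `a` sends the vector of `𝟙 X` to that of `a`, whose squared norm is `φ(a* a)`.
theorem gnsFunctor_faithful : (gnsFunctor C).Faithful := by
  classical
  intro X Y
  refine (injective_iff_map_eq_zero _).mpr fun a ha => ?_
  by_contra hne
  obtain ⟨φ, hadj, hnonneg, hφ⟩ := EndPositive.exists_of_ne_zero hne
  let d : EndPositive C := ⟨X, φ, hadj, hnonneg⟩
  let T : lp (fun d : EndPositive C => d.Space X) 2 →L[ℂ]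
      lp (fun d : EndPositive C => d.Space Y) 2 :=
    diagMap (fun d : EndPositive C => d.opMap a) ‖a‖ (norm_nonneg a) fun d => d.norm_opMap_le a
  have hT : T = 0 := ha
  have h1 : T (lp.single 2 d (d.vec (𝟙 X))) d = d.vec a := by
    rw [diagMap_apply, lp.single_apply_self, EndPositive.opMap_vec, id_comp]
  rw [hT] at h1
  have h2 : d.vec a = 0 := h1.symm
  have h3 := d.inner_vec a a
  rw [h2, inner_zero_left] at h3
  exact hφ h3.symm

end GNSFunctor

theorem mainTheorem12 {C : Type u} [CStarCategoryStruct.{u, v} C] [IsCStarCategory C] :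
    -- there is a faithful C*-functor to Hilbert spaces
    (∃ ρ : CStarFunctor C HilbSp.{max u v}, ρ.Faithful) ∧
    -- and for every such functor
    ∀ ρ : CStarFunctor C HilbSp.{w}, ρ.Faithful →
      -- `τ` extends `σ` and is a homeomorphism of `(X, Y)''` (weak* topology) onto `𝒮(X, Y)`
      -- (weak operator topology)
      (∀ (X Y : C) (a : X ⟶ Y), ρ.tau (hat a) = ρ.sigma a) ∧
      (∀ X Y : C, Topology.IsEmbedding (fun F : WeakDual ℂ (StrongDual ℂ (X ⟶ Y)) =>
          ContinuousLinearMapWOT.ofCLM (ρ.tau (WeakDual.toStrongDual F)))) ∧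
      (∀ X Y : C, Set.range (fun F : Bidual X Y => ContinuousLinearMapWOT.ofCLM (ρ.tau F)) =
          ρ.wotClosure X Y) ∧
      -- `G • F` is well defined
      (∀ (X Y Z : C) (G : Bidual Y Z) (F : Bidual X Y),
          ContinuousLinearMapWOT.ofCLM (ρ.tau G ∘L ρ.tau F) ∈ ρ.wotClosure X Z ∧
            ρ.tau (ρ.stComp G F) = ρ.tau G ∘L ρ.tau F) ∧
      -- both biduals are C*-categories, with the same composition, and they coincide
      @IsCStarCategory C ρ.shermanTakedaBidual ∧
      @IsCStarCategory C (arensBidual C) ∧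
      (∀ (X Y Z : C) (G : Bidual Y Z) (F : Bidual X Y), arensComp G F = ρ.stComp G F) ∧
      arensBidual C = ρ.shermanTakedaBidual := by
  refine ⟨⟨gnsFunctor C, gnsFunctor_faithful C⟩, fun ρ hρ => ?_⟩
  refine ⟨fun X Y a => ρ.tau_hat a, hρ.isEmbedding_tau, hρ.range_tau, fun X Y Z G F => ⟨?_, ?_⟩,
    ?_, hρ.isCStarCategory_arensBidual, fun X Y Z G F => (hρ.stComp_eq_arensComp G F).symm,
    hρ.arensBidual_eq⟩
  · rw [← hρ.range_tau, ← ρ.tau_arensComp]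
    exact ⟨arensComp G F, rfl⟩
  · rw [hρ.stComp_eq_arensComp, ρ.tau_arensComp]
  · rw [← hρ.arensBidual_eq]
    exact hρ.isCStarCategory_arensBidual
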